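/- Let $n,h\ge 1$, $X\subseteq\mathbb R^m$, $\mathcal A=\{u:\mathbb Z^n\to X\}$, $L\in\mathbb R$, $\varphi:\mathcal A\to[0,L]$, and let $v_1,\dots,v_K\in\mathcal A$ be distinct functions that are $h$-periodic in each coordinate direction. Write $u^i=u(i)$, $\{u^{i+j}\}_j$ for the translate of $u$ by $i$, and $Q=(-\frac12,\frac12)^n$. Assume: (H1) for $z\in\mathcal A$: $\varphi(\{z^{i+j}\}_j)=0$ for all $i\in\mathbb Z^n$ if and only if $z=v_l$ for some $l$; (H2) there are integers $M'\ge M\ge 2$ and $C_M>0$ such that, if $u\in\mathcal A$ and $i\in\mathbb Z^n$ are such that for every $l$ there is $j\in\mathbb Z^n\cap(i+MhQ)$ with $u^j\ne v_l^j$, then $\varphi(\{u^{i'+j}\}_j)\ge C_M$ for some $i'\in\mathbb Z^n\cap(i+M'hQ)$; (H3) there are constants $c_m$ with $\sum_{m\ge1}c_m m^{n-1}<\infty$ such that $|\varphi(w)-\varphi(z)|\le c_m$ whenever $m\ge 1$ and $z,w\in\mathcal A$ agree on $mQ\cap\mathbb Z^n$. For $\varepsilon>0$ and open $\Omega\subseteq\mathbb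 R^n$ put $$F_\varepsilon(u,\Omega)=\sum_{i\in\mathbb Z^n,\ \varepsilon i\in\Omega}\varepsilon^{n-1}\varphi(\{u^{i+j}\}_j).$$ Let $Q'=[-\frac12,\frac12)^n$. For $u\in\mathcal A$, the $l$-th phase $A_{\varepsilon,l}(u)$ is the union of the cells $\varepsilon(jh+hQ')$ over those $j\in\mathbb Z^n$ for which $u=v_l$ on $(jh+hQ')\cap\mathbb Z^n$. For a sequence $\varepsilon_k\to0^+$, we say $u_{k}\to\mathbb A=(A_1,\dots,A_K)$ if $|(A_{\varepsilon_k,l}(u_k)\,\Delta\, A_l)\cap RQ|\to0$ for all $l$ and all $R>0$. Let $\mathcal P$ be the set of partitions $\mathbb A=(A_1,\dots,A_K)$ of $\mathbb R^n$ (up to null sets) into sets of finite perimeter in $\mathbb R^n$. Let $\Omega\subset\mathbb R^n$ be a bounded open set with Lipschitz boundary, let $\mathbb A_0\in\mathcal P$ and $\varepsilon_k\to0^+$, and suppose that the $\Gamma$-limit $F_0(\mathbb A,\Omega)\in[0,\infty]$ of $F_{\varepsilon_k}(\cdot,\Omega)$ with respect to the convergence above exists on $\mathcal P$; that is, for every $\mathbb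 A\in\mathcal P$, $F_0(\mathbb A,\Omega)\le\liminf_kF_{\varepsilon_k}(u_k,\Omega)$ whenever $u_k\to\mathbb A$, and there is $u_k\to\mathbb A$ with $\limsup_kF_{\varepsilon_k}(u_k,\Omega)\le F_0(\mathbb A,\Omega)$. For $\delta>0$ let $\Omega_\delta=\{x\in\Omega:\operatorname{dist}(x,\mathbb R^n\setminus\Omega)>\delta\}$. Let $u_{0,k}\in\mathcal A$ satisfy $u_{0,k}\to\mathbb A_0$ and $$\inf_{\delta>0}\limsup_{k\to\infty}F_{\varepsilon_k}(u_{0,k},\Omega\setminus\overline{\Omega_{2\delta}})=0.$$ Set $$m_{k,\delta}=\inf\bigl\{F_{\varepsilon_k}(u,\Omega):\ u\in\mathcal A,\ u^i=u_{0,k}^i\text{ for all }i\in\mathbb Z^n\setminus\tfrac1{\varepsilon_k}\Omega_\delta\bigr\},$$ $$m_{0,\delta}=\inf\bigl\{F_0(\mathbb A,\Omega):\ \mathbb A\in\mathcal P,\ \mathbb A=\mathbb A_0\text{ a.e. on }\mathbb R^n\setminus\Omega_\delta\bigr\}.$$ Then $$\inf_{\delta>0}\limsup_{k\to\infty}m_{k,\delta}\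 \le\ \inf_{\delta>0}m_{0,\delta}\ \le\ \inf_{\delta>0}\liminf_{k\to\infty}m_{k,\delta}.$$ Moreover, for every $\delta>0$ the infimum defining $m_{0,\delta}$ is a minimum, and if $X$ is finite then the infimum defining $m_{k,\delta}$ is a minimum for every $k$ and every $\delta>0$. -/

import Mathlib

open Set Filter Topology MeasureTheory
open scoped ENNReal

namespace PatternEnergy

noncomputable section

/-- `ℝⁿ` with the Euclidean norm. -/
abbrev Space (n : ℕ) : Type := EuclideanSpace ℝ (Fin n)

/-- Discrete functions `u : ℤⁿ → X`. -/
abbrev Config (n : ℕ) (X : Type*) : Type _ := (Fin n → ℤ) → X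

/-- The translated function `{u^{i+j}}_j`. -/
def shift {n : ℕ} {X : Type*} (i : Fin n → ℤ) (u : Config n X) : Config n X :=
  fun j => u (i + j)

/-- The point `ε i` of `ℝⁿ`. -/
def latticePoint {n : ℕ} (ε : ℝ) (i : Fin n → ℤ) : Space n :=
  WithLp.toLp 2 (fun a => ε * (i a : ℝ))

/-- `j ∈ i + s Q`, where `Q = (-1/2, 1/2)ⁿ` is the open unit cube and `i, j ∈ ℤⁿ`. -/
def InCube {n : ℕ} (i : Fin n → ℤ) (s : ℝ) (j : Fin n → ℤ) : Prop :=
  ∀ a, |((j a - i a : ℤ) : ℝ)| < s / 2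

/-! ### The assumptions on the energy density -/

/-- `v` is `h`-periodic in every coordinate direction. -/
def IsPeriodic {n : ℕ} {X : Type*} (h : ℕ) (v : Config n X) : Prop :=
  ∀ (a : Fin n) (j : Fin n → ℤ), v (j + Pi.single a (h : ℤ)) = v j

/-- (H1): the functions with zero energy density at every site are exactly `v_1, …, v_K`. -/
def GroundStates {n K : ℕ} {X : Type*} (φ : Config n X → ℝ) (v : Fin K → Config n X) : Prop :=
  ∀ z : Config n X, (∀ i, φ (shift i z) = 0) ↔ ∃ l, z = v l

/-- (H2): coerciveness. -/
def Coercive {n K : ℕ} {X : Type*} (φ : Config n X → ℝ) (h : ℕ) (v : Fin K → Config n X) :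
    Prop :=
  ∃ (M M' : ℕ) (C : ℝ), 2 ≤ M ∧ M ≤ M' ∧ 0 < C ∧
    ∀ (u : Config n X) (i : Fin n → ℤ),
      (∀ l, ∃ j, InCube i ((M : ℝ) * h) j ∧ u j ≠ v l j) →
        ∃ i', InCube i ((M' : ℝ) * h) i' ∧ C ≤ φ (shift i' u)

/-- (H3): mild non-locality. -/
def MildlyNonlocal {n : ℕ} {X : Type*} (φ : Config n X → ℝ) : Prop :=
  ∃ c : ℕ → ℝ, (Summable fun m : ℕ => c m * (m : ℝ) ^ (n - 1)) ∧
    ∀ (m : ℕ), 1 ≤ m → ∀ z w : Config n X,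
      (∀ j, InCube 0 (m : ℝ) j → z j = w j) → |φ w - φ z| ≤ c m

/-! ### The scaled energies -/

/-- `F_ε(u, Ω) = ∑_{i ∈ ℤⁿ, ε i ∈ Ω} ε^{n-1} φ({u^{i+j}}_j)`. -/
def energy {n : ℕ} {X : Type*} (φ : Config n X → ℝ) (ε : ℝ) (u : Config n X)
    (Ω : Set (Space n)) : ℝ≥0∞ :=
  ∑' i : {i : Fin n → ℤ // latticePoint ε i ∈ Ω}, ENNReal.ofReal (ε ^ (n - 1) * φ (shift i.1 u))

/-! ### From functions to sets -/

/-- `x ∈ j h + h Q`, for the half-open unit cube `Q = [-1/2, 1/2)ⁿ`. The half-open cells tile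
`ℝⁿ`, so that each of them contains exactly `hⁿ` lattice points, for even `h` as well. -/
def InCell {n : ℕ} (h : ℕ) (j : Fin n → ℤ) (x : Fin n → ℝ) : Prop :=
  ∀ a, (h : ℝ) * (j a : ℝ) - (h : ℝ) / 2 ≤ x a ∧ x a < (h : ℝ) * (j a : ℝ) + (h : ℝ) / 2

/-- `I_l(u)`, for `v = v_l`: the indices `j` such that `u = v` on the lattice points of the
`j`-th cell. -/
def phaseIndices {n : ℕ} {X : Type*} (h : ℕ) (v u : Config n X) : Set (Fin n → ℤ) :=
  {j | ∀ i : Fin n → ℤ, InCell h j (fun a => (i a : ℝ)) → u i = v i}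

/-- The phase `A_{ε,l}(u)`, for `v = v_l`: the union of the cells `ε (j h + h Q)`,
`j ∈ I_l(u)`. -/
def phase {n : ℕ} {X : Type*} (h : ℕ) (v : Config n X) (ε : ℝ) (u : Config n X) :
    Set (Space n) :=
  {x | ∃ j ∈ phaseIndices h v u, ∃ y : Fin n → ℝ, InCell h j y ∧ ∀ a, x a = ε * y a}

/-- The convergence `u_k → 𝔸` along the parameters `ε_k`: for every `l` and every `R > 0`,
`|(A_{ε_k,l}(u_k) Δ A_l) ∩ R Q| → 0`. -/
def ConvergesTo {n K : ℕ} {X : Type*} (h : ℕ) (v : Fin K → Config n X) (ε : ℕ → ℝ)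
    (u : ℕ → Config n X) (A : Fin K → Set (Space n)) : Prop :=
  ∀ (l : Fin K) (R : ℝ), 0 < R →
    Tendsto
      (fun k => volume (symmDiff (phase h (v l) (ε k) (u k)) (A l) ∩
        {x : Space n | ∀ a, |x a| < R / 2}))
      atTop (𝓝 0)

/-! ### Partitions into sets of finite perimeter -/

/-- The divergence of a vector field on `ℝⁿ`. -/
def divergence {n : ℕ} (T : Space n → Space n) (x : Space n) : ℝ :=
  ∑ a : Fin n, (fderiv ℝ T x (EuclideanSpace.single a 1)) a

/-- `A` is a (Lebesgue measurable) set of finite perimeter in `ℝⁿ`: the distributional derivative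
of its characteristic function has finite total variation, i.e. `∫_A div T` is bounded above
among the `C¹` fields `T` with compact support and `|T| ≤ 1`. -/
def HasFinitePerimeter {n : ℕ} (A : Set (Space n)) : Prop :=
  NullMeasurableSet A volume ∧
    ∃ C : ℝ, ∀ T : Space n → Space n, ContDiff ℝ 1 T → HasCompactSupport T →
      (∀ x, ‖T x‖ ≤ 1) → ∫ x in A, divergence T x ≤ C

/-- `(A_1, …, A_K)` is a partition of `ℝⁿ` (up to Lebesgue null sets) into sets of finite
perimeter. -/
def IsFinitePerimeterPartition {n K : ℕ} (A : Fin K → Set (Space n)) : Prop :=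
  (∀ l, HasFinitePerimeter (A l)) ∧
    (∀ l l', l ≠ l' → volume (A l ∩ A l') = 0) ∧
    volume (⋃ l, A l)ᶜ = 0

/-! ### Γ-convergence -/

/-- `F₀` is the `Γ`-limit of `F_{ε_k}(·, Ω)` with respect to the convergence `u_k → 𝔸`, on the
partitions of `ℝⁿ` into sets of finite perimeter. -/
def IsGammaLimit {n K : ℕ} {X : Type*} (φ : Config n X → ℝ) (h : ℕ) (v : Fin K → Config n X)
    (ε : ℕ → ℝ) (Ω : Set (Space n)) (F₀ : (Fin K → Set (Space n)) → ℝ≥0∞) : Prop :=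
  ∀ A : Fin K → Set (Space n), IsFinitePerimeterPartition A →
    (∀ u : ℕ → Config n X, ConvergesTo h v ε u A →
      F₀ A ≤ liminf (fun k => energy φ (ε k) (u k) Ω) atTop) ∧
    ∃ u : ℕ → Config n X, ConvergesTo h v ε u A ∧
      limsup (fun k => energy φ (ε k) (u k) Ω) atTop ≤ F₀ A

/-! ### Lipschitz sets and boundary-value problems -/

/-- `Ω` is an open set with Lipschitz boundary: near each boundary point, `Ω` is the set of points
lying below the graph of a Lipschitz function of the variables orthogonal to a unit vector `ν`. -/
def IsLipschitzSet {n : ℕ} (Ω : Set (Space n)) : Prop :=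
  IsOpen Ω ∧ ∀ x ∈ frontier Ω, ∃ (ν : Space n) (r : ℝ) (γ : Space n → ℝ),
    ‖ν‖ = 1 ∧ 0 < r ∧ (∃ κ, LipschitzWith κ γ) ∧
      ∀ y ∈ Metric.ball x r, y ∈ Ω ↔ inner ℝ ν y < γ (y - (inner ℝ ν y) • ν)

/-- `Ω_δ = {x ∈ Ω : dist(x, ℝⁿ \ Ω) > δ}`. -/
def innerSet {n : ℕ} (Ω : Set (Space n)) (δ : ℝ) : Set (Space n) :=
  {x | x ∈ Ω ∧ δ < Metric.infDist x Ωᶜ}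

/-- The admissible functions of the discrete problem: `u = u₀` on `ℤⁿ \ (1/ε) Ω_δ`. -/
def discreteAdmissible {n : ℕ} {X : Type*} (Ω : Set (Space n)) (ε δ : ℝ) (u₀ : Config n X) :
    Set (Config n X) :=
  {u | ∀ i : Fin n → ℤ, latticePoint ε i ∉ innerSet Ω δ → u i = u₀ i}

/-- The admissible partitions of the continuum problem: partitions of `ℝⁿ` into sets of finite
perimeter which agree with `A₀` (up to null sets) on `ℝⁿ \ Ω_δ`. -/
def continuumAdmissible {n K : ℕ} (Ω : Set (Space n)) (δ : ℝ) (A₀ : Fin K → Set (Space n)) :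
    Set (Fin K → Set (Space n)) :=
  {A | IsFinitePerimeterPartition A ∧
    ∀ l, volume (symmDiff (A l) (A₀ l) ∩ (innerSet Ω δ)ᶜ) = 0}

/-- `m_{ε,δ}`, the infimum (minimum value, when attained) of the discrete boundary-value problem. -/
def discreteMin {n : ℕ} {X : Type*} (φ : Config n X → ℝ) (Ω : Set (Space n)) (ε δ : ℝ)
    (u₀ : Config n X) : ℝ≥0∞ :=
  ⨅ u ∈ discreteAdmissible Ω ε δ u₀, energy φ ε u Ω

/-- `m_{0,δ}`, the infimum (minimum value, when attained) of the continuum boundary-value problem. -/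
def continuumMin {n K : ℕ} (F₀ : (Fin K → Set (Space n)) → ℝ≥0∞) (Ω : Set (Space n)) (δ : ℝ)
    (A₀ : Fin K → Set (Space n)) : ℝ≥0∞ :=
  ⨅ A ∈ continuumAdmissible Ω δ A₀, F₀ A

end

end PatternEnergy

open PatternEnergy

open Set Filter Topology MeasureTheory
open scoped ENNReal

namespace PatternEnergy

noncomputable section

/-! ### Boxes, cells and distances -/

/-! The energy controls the interfaces between phases. Everything rests on
`exists_energy_of_isDefect`: a site around which `u` agrees with no ground state forces a fixed
amount of energy at bounded distance. Counting such defects gives `exists_volume_le_energy`: away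
from the boundary of `Ω`, the volume left uncovered by the phases is at most `C ε` times the energy,
and the volume where a phase differs from its translate by `τ` is at most `C (‖τ‖ + 3 ε)` times the
energy. The second bound yields compactness of the phases in L¹ and, in the limit, a bound linear in
`‖τ‖` on the differences between the limit sets and their translates, hence finite perimeter. With
the liminf inequality this gives `exists_continuumAdmissible_le`: if energies are bounded by a
convergent sequence and the phases tend to `A₀` outside `Ω_δ`, some admissible partition has `F₀` at
most the limit of the bounds.

The lower bound applies this to near-minimisers of the discrete problems, whose phases coincide with
those of `u₀` outside `Ω_δ'` for any `δ' < δ` and small `ε`. Existence of continuum minimisers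
applies it to a diagonal sequence built from recovery sequences of a minimising sequence of
partitions.

For the upper bound, a recovery sequence of an admissible `A` is glued to `u₀` along a level set of
the distance to the complement of `Ω`. In the boundary layer both sequences converge to the same
partition, so they differ there at only o(ε⁻ⁿ) sites. There are of order 1/ε levels to choose from,
and averaging over them (`exists_cut`) finds one whose gluing error tends to zero, because (H3)
makes sites far from the cut contribute a summable amount. -/

theorem measurableSet_box {n : ℕ} (c : Fin n → ℝ) (s : ℝ) :
    MeasurableSet {x : Space n | ∀ a, c a ≤ x a ∧ x a < c a + s} := by
  have : {x : Space n | ∀ a, c a ≤ x a ∧ x a < c a + s}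
      = ⋂ a, {x : Space n | c a ≤ x a ∧ x a < c a + s} := by ext; simp
  rw [this]
  refine MeasurableSet.iInter fun a => ?_
  have hm : Measurable fun x : Space n => x a := by fun_prop
  exact (measurableSet_le measurable_const hm).inter (measurableSet_lt hm measurable_const)

theorem volume_box {n : ℕ} (c : Fin n → ℝ) (s : ℝ) :
    volume {x : Space n | ∀ a, c a ≤ x a ∧ x a < c a + s} = ENNReal.ofReal s ^ n := by
  have h1 : {x : Space n | ∀ a, c a ≤ x a ∧ x a < c a + s}
      = (WithLp.ofLp : Space n → (Fin n → ℝ)) ⁻¹'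
        (Set.pi univ fun a => Set.Ico (c a) (c a + s)) := by
    ext x; simp
  rw [h1, (PiLp.volume_preserving_ofLp (Fin n)).measure_preimage, Real.volume_pi_Ico]
  · simp
  · exact (MeasurableSet.univ_pi fun a => measurableSet_Ico).nullMeasurableSet

theorem dist_le_mul_of_coord {n : ℕ} {x y : Space n} {r : ℝ}
    (h : ∀ a, |x a - y a| ≤ r) : dist x y ≤ n * r := by
  rcases Nat.eq_zero_or_pos n with rfl | hn
  · have : x = y := Subsingleton.elim _ _
    simp [this]
  have hr : 0 ≤ r := (abs_nonneg _).trans (h ⟨0, hn⟩)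
  rw [EuclideanSpace.dist_eq]
  apply Real.sqrt_le_iff.2
  refine ⟨by positivity, ?_⟩
  have h1 : ∀ a, dist (x a) (y a) ^ 2 ≤ r ^ 2 := fun a => by
    rw [Real.dist_eq]
    exact pow_le_pow_left₀ (abs_nonneg _) (h a) 2
  calc ∑ a, dist (x a) (y a) ^ 2 ≤ ∑ _a : Fin n, r ^ 2 := Finset.sum_le_sum fun a _ => h1 a
    _ = n * r ^ 2 := by simp
    _ ≤ (n * r) ^ 2 := by
      have : (1 : ℝ) ≤ n := by exact_mod_cast hn
      nlinarith [mul_nonneg (mul_nonneg (sub_nonneg.2 this) (by positivity : (0:ℝ) ≤ n)) (sq_nonneg r)]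

theorem abs_coord_le_norm {n : ℕ} (x : Space n) (a : Fin n) : |x a| ≤ ‖x‖ := by
  simpa using PiLp.norm_apply_le x a

theorem inCell_iff {n h : ℕ} (hh : 1 ≤ h) (j : Fin n → ℤ) (x : Fin n → ℝ) :
    InCell h j x ↔ ∀ a, ⌊x a / h + 1 / 2⌋ = j a := by
  have hpos : (0 : ℝ) < h := by exact_mod_cast hh
  refine forall_congr' fun a => ?_
  rw [Int.floor_eq_iff]
  have e : x a = h * (x a / h) := by field_simp
  constructor
  · rintro ⟨h1, h2⟩
    rw [e] at h1 h2
    constructor <;> nlinarith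
  · rintro ⟨h1, h2⟩
    rw [e]
    constructor <;> nlinarith

theorem InCell.eq {n h : ℕ} (hh : 1 ≤ h) {j j' : Fin n → ℤ} {x : Fin n → ℝ}
    (h1 : InCell h j x) (h2 : InCell h j' x) : j = j' := by
  rw [inCell_iff hh] at h1 h2
  funext a
  rw [← h1 a, h2 a]

/-- The index of the cell of side `ε h` which contains `x`. -/
def cellIndex {n : ℕ} (h : ℕ) (ε : ℝ) (x : Space n) : Fin n → ℤ :=
  fun a => ⌊x a / ε / h + 1 / 2⌋

theorem inCell_cellIndex {n h : ℕ} (hh : 1 ≤ h) (ε : ℝ) (x : Space n) :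
    InCell h (cellIndex h ε x) (fun a => x a / ε) := (inCell_iff hh _ _).2 fun _ => rfl

theorem mem_phase_iff {n h : ℕ} {X : Type*} (hh : 1 ≤ h) {ε : ℝ} (hε : 0 < ε)
    (v u : Config n X) (x : Space n) :
    x ∈ phase h v ε u ↔ cellIndex h ε x ∈ phaseIndices h v u := by
  constructor
  · rintro ⟨j, hj, y, hy, hxy⟩
    have : cellIndex h ε x = j := by
      refine (inCell_cellIndex hh ε x).eq hh ?_
      have : (fun a => x a / ε) = y := by
        funext a; rw [hxy a]; field_simp
      rwa [this]
    rwa [this]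
  · intro hx
    exact ⟨_, hx, _, inCell_cellIndex hh ε x, fun a => by field_simp⟩

theorem measurable_cellIndex {n h : ℕ} (ε : ℝ) :
    Measurable (cellIndex h ε : Space n → Fin n → ℤ) := by
  refine measurable_pi_iff.2 fun a => ?_
  exact Int.measurable_floor.comp (by fun_prop)

theorem measurableSet_phase {n h : ℕ} {X : Type*} (hh : 1 ≤ h) {ε : ℝ} (hε : 0 < ε)
    (v u : Config n X) : MeasurableSet (phase h v ε u) := by
  have : phase h v ε u = cellIndex h ε ⁻¹' phaseIndices h v u := by
    ext x; exact mem_phase_iff hh hε v u x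
  rw [this]
  exact measurable_cellIndex ε (MeasurableSet.of_discrete)

/-! ### Periodic functions and their values on one cell. -/

theorem IsPeriodic.add_mul {n h : ℕ} {X : Type*} {v : Config n X} (hv : IsPeriodic h v)
    (j q : Fin n → ℤ) : v (j + fun a => (h : ℤ) * q a) = v j := by
  have h1 : ∀ (a : Fin n) (q : ℤ) (j : Fin n → ℤ), v (j + Pi.single a ((h : ℤ) * q)) = v j := by
    intro a q
    induction q using Int.induction_on with
    | zero => simp
    | succ k ih =>
      intro j
      rw [mul_add, mul_one, Pi.single_add, ← add_assoc, hv, ih]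
    | pred k ih =>
      intro j
      have h2 := hv a (j + Pi.single a ((h : ℤ) * (-k - 1)))
      rw [add_assoc, ← Pi.single_add, show (h : ℤ) * (-k - 1) + h = h * -k by ring, ih] at h2
      exact h2.symm
  have h2 : ∀ (s : Finset (Fin n)) (j : Fin n → ℤ),
      v (j + ∑ a ∈ s, Pi.single a ((h : ℤ) * q a)) = v j := by
    intro s
    induction s using Finset.induction_on with
    | empty => simp
    | insert a s ha ih =>
      intro j
      rw [Finset.sum_insert ha, ← add_assoc, ih, h1]
  have h3 := h2 Finset.univ j
  rwa [Finset.univ_sum_single] at h3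

/-- A half-open cell contains a representative of every residue class modulo `h`. This is what makes
the phases of distinct ground states disjoint. -/
theorem IsPeriodic.eq_of_eqOn_cell {n h : ℕ} {X : Type*} (hh : 1 ≤ h) {v w : Config n X}
    (hv : IsPeriodic h v) (hw : IsPeriodic h w) (z : Fin n → ℤ)
    (H : ∀ i : Fin n → ℤ, InCell h z (fun a => (i a : ℝ)) → v i = w i) : v = w := by
  funext j
  have hpos : (h : ℝ) ≠ 0 := by positivity
  rw [← hv.add_mul j (fun a => z a - ⌊(j a : ℝ) / h + 1 / 2⌋),
    ← hw.add_mul j (fun a => z a - ⌊(j a : ℝ) / h + 1 / 2⌋)]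
  apply H
  rw [inCell_iff hh]
  intro a
  simp only [Pi.add_apply]
  push_cast
  rw [show ((j a : ℝ) + h * (z a - ⌊(j a : ℝ) / h + 1 / 2⌋)) / h + 1 / 2
    = ((j a : ℝ) / h + 1 / 2) + ((z a - ⌊(j a : ℝ) / h + 1 / 2⌋ : ℤ) : ℝ) by
      push_cast; field_simp; ring, Int.floor_add_intCast]
  ring

/-! ### Inner parallel sets -/

theorem mem_innerSet_iff {n : ℕ} {Ω : Set (Space n)} {δ : ℝ} (hδ : 0 ≤ δ) {x : Space n} :
    x ∈ innerSet Ω δ ↔ δ < Metric.infDist x Ωᶜ := by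
  refine ⟨fun h => h.2, fun h => ⟨?_, h⟩⟩
  by_contra hx
  have : Metric.infDist x Ωᶜ = 0 := Metric.infDist_zero_of_mem hx
  linarith

theorem isOpen_innerSet {n : ℕ} {Ω : Set (Space n)} {δ : ℝ} (hδ : 0 ≤ δ) :
    IsOpen (innerSet Ω δ) := by
  have : innerSet Ω δ = {x | δ < Metric.infDist x Ωᶜ} := by ext x; exact mem_innerSet_iff hδ
  rw [this]
  exact isOpen_lt continuous_const (Metric.continuous_infDist_pt _)

theorem innerSet_anti {n : ℕ} {Ω : Set (Space n)} {δ δ' : ℝ} (h : δ ≤ δ') :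
    innerSet Ω δ' ⊆ innerSet Ω δ := fun _ hx => ⟨hx.1, h.trans_lt hx.2⟩

theorem innerSet_subset {n : ℕ} {Ω : Set (Space n)} {δ : ℝ} : innerSet Ω δ ⊆ Ω := fun _ hx => hx.1

theorem mem_innerSet_of_dist_le {n : ℕ} {Ω : Set (Space n)} {δ δ' r : ℝ} (hδ' : 0 ≤ δ')
    (h : δ' + r ≤ δ) {x y : Space n} (hx : x ∈ innerSet Ω δ) (hxy : dist x y ≤ r) :
    y ∈ innerSet Ω δ' := by
  rw [mem_innerSet_iff hδ']
  have h1 := hx.2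
  have h2 := Metric.infDist_le_infDist_add_dist (s := Ωᶜ) (x := x) (y := y)
  linarith

/-! ### Lattice sites -/

/-- The lattice site `⌊x / ε⌋`. -/
def site {n : ℕ} (ε : ℝ) (x : Space n) : Fin n → ℤ := fun a => ⌊x a / ε⌋

theorem site_eq_iff {n : ℕ} {ε : ℝ} (hε : 0 < ε) (x : Space n) (i : Fin n → ℤ) :
    site ε x = i ↔ ∀ a, ε * i a ≤ x a ∧ x a < ε * i a + ε := by
  rw [funext_iff]
  refine forall_congr' fun a => ?_
  rw [site, Int.floor_eq_iff, le_div_iff₀ hε, div_lt_iff₀ hε]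
  constructor <;> rintro ⟨h1, h2⟩ <;> constructor <;> nlinarith

theorem measurable_site {n : ℕ} (ε : ℝ) : Measurable (site ε : Space n → Fin n → ℤ) := by
  refine measurable_pi_iff.2 fun a => ?_
  exact Int.measurable_floor.comp (by fun_prop)

theorem dist_latticePoint_site {n : ℕ} {ε : ℝ} (hε : 0 < ε) (x : Space n) :
    dist x (latticePoint ε (site ε x)) ≤ n * ε := by
  apply dist_le_mul_of_coord
  intro a
  have := (site_eq_iff hε x _).1 rfl a
  simp only [latticePoint]
  rw [abs_le]
  constructor <;> linarith

theorem volume_site_preimage_le {n : ℕ} {ε : ℝ} (hε : 0 < ε) (S : Set (Fin n → ℤ)) :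
    volume {x : Space n | site ε x ∈ S} ≤ ∑' _ : S, ENNReal.ofReal ε ^ n := by
  have : {x : Space n | site ε x ∈ S}
      = ⋃ i : S, {x : Space n | ∀ a, ε * i.1 a ≤ x a ∧ x a < ε * i.1 a + ε} := by
    ext x
    simp only [mem_ofPred_eq, mem_iUnion]
    constructor
    · exact fun hx => ⟨⟨_, hx⟩, (site_eq_iff hε x _).1 rfl⟩
    · rintro ⟨i, hi⟩
      rw [(site_eq_iff hε x i.1).2 hi]
      exact i.2
  rw [this]
  refine (measure_iUnion_le _).trans (ENNReal.tsum_le_tsum fun i => ?_)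
  rw [volume_box]

theorem dist_latticePoint_le {n : ℕ} {ε r : ℝ} (hε : 0 ≤ ε) {i j : Fin n → ℤ}
    (h : ∀ a, |((i a - j a : ℤ) : ℝ)| ≤ r) :
    dist (latticePoint ε i) (latticePoint ε j) ≤ n * (ε * r) := by
  apply dist_le_mul_of_coord
  intro a
  simp only [latticePoint]
  rw [← mul_sub, abs_mul, abs_of_nonneg hε]
  have := h a
  push_cast at this
  gcongr

/-! ### Strong coerciveness -/

/-- For `m ≥ 1` the weight `m ^ (n - 1)` is at least 1, so the absolute values of the constants are
summable. The value at `m = 0`, which plays no role in (H3), is set to 0. -/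
theorem MildlyNonlocal.exists_summable {n : ℕ} {X : Type*} {φ : Config n X → ℝ}
    (H : MildlyNonlocal φ) :
    ∃ c : ℕ → ℝ, Summable c ∧ (∀ m, 0 ≤ c m) ∧ ∀ m : ℕ, 1 ≤ m → ∀ z w : Config n X,
      (∀ j, InCube 0 (m : ℝ) j → z j = w j) → |φ w - φ z| ≤ c m := by
  obtain ⟨c, hc, H⟩ := H
  refine ⟨fun m => if m = 0 then 0 else |c m|, ?_, ?_, ?_⟩
  · refine Summable.of_nonneg_of_le (fun m => ?_) (fun m => ?_) hc.abs
    · split_ifs <;> positivity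
    · split_ifs with h
      · positivity
      · rw [abs_mul]
        refine le_mul_of_one_le_right (abs_nonneg _) ?_
        rw [abs_of_nonneg (by positivity)]
        exact one_le_pow₀ (by exact_mod_cast Nat.one_le_iff_ne_zero.2 h)
  · intro m
    dsimp only; split_ifs <;> positivity
  · intro m hm z w h
    simp only [if_neg (show m ≠ 0 by omega)]
    exact (H m hm z w h).trans (le_abs_self _)

theorem shift_shift {n : ℕ} {X : Type*} (i i' : Fin n → ℤ) (u : Config n X) :
    shift i' (shift i u) = shift (i + i') u := by
  funext j
  simp [shift, add_assoc]

/-- The site `i` is a defect of `u` when `u` differs from each of the ground states on the cube of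
radius `N` around `i`. -/
def IsDefect {n K : ℕ} {X : Type*} (v : Fin K → Config n X) (N : ℕ) (u : Config n X)
    (i : Fin n → ℤ) : Prop :=
  ∀ l, ∃ j : Fin n → ℤ, (∀ a, |j a - i a| ≤ (N : ℤ)) ∧ u j ≠ v l j

/-- A translate of a ground state still has zero density at every site, so (H1) applies to it. This
allows defects to be moved to the origin. -/
theorem GroundStates.exists_shift_eq {n K : ℕ} {X : Type*} {φ : Config n X → ℝ}
    {v : Fin K → Config n X} (H1 : GroundStates φ v) (i : Fin n → ℤ) (l : Fin K) :
    ∃ l', shift i (v l) = v l' := by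
  refine (H1 _).1 fun i' => ?_
  rw [shift_shift]
  exact (H1 (v l)).2 ⟨l, rfl⟩ _

theorem IsDefect.shift {n K : ℕ} {X : Type*} {φ : Config n X → ℝ} {v : Fin K → Config n X}
    (H1 : GroundStates φ v) {N : ℕ} {u : Config n X} {i : Fin n → ℤ} (h : IsDefect v N u i) :
    IsDefect v N (shift i u) 0 := by
  intro l
  obtain ⟨l', hl'⟩ := H1.exists_shift_eq (-i) l
  obtain ⟨j, hj, hne⟩ := h l'
  refine ⟨j - i, fun a => by simpa using hj a, ?_⟩
  rw [← hl'] at hne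
  have e1 : PatternEnergy.shift i u (j - i) = u j := by simp [PatternEnergy.shift]
  have e2 : PatternEnergy.shift (-i) (v l) j = v l (j - i) := by
    simp only [PatternEnergy.shift]; congr 1; abel
  rwa [e1, ← e2]

theorem finite_box {n : ℕ} (N : ℤ) (i : Fin n → ℤ) :
    {j : Fin n → ℤ | ∀ a, |j a - i a| ≤ N}.Finite := by
  refine (Set.Finite.pi' fun a : Fin n => Set.finite_Icc (i a - N) (i a + N)).subset ?_
  intro j hj a
  have := abs_le.1 (hj a)
  constructor <;> linarith

/-- (H2) gives this for one size of cube; compactness extends it to every `N`. Otherwise there are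
functions with a defect at 0 whose densities are below `1 / (R + 1)` at all sites of radius `R`. By
(H2) each site eventually carries the value of some ground state, so finitely many labels describe
it, and Tychonoff gives a subsequence that stabilises at every site without any compactness of `X`.
By (H3) the limit has zero density everywhere, so by (H1) it is a ground state, which contradicts
the defect at 0. -/
theorem exists_energy_of_isDefect {n K h : ℕ} (hh : 1 ≤ h) {X : Type*} {φ : Config n X → ℝ}
    (hφ : ∀ u, 0 ≤ φ u) {v : Fin K → Config n X}
    (H1 : GroundStates φ v) (H2 : Coercive φ h v) (H3 : MildlyNonlocal φ) (N : ℕ) :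
    ∃ (R : ℕ) (C : ℝ), 0 < C ∧ ∀ (u : Config n X) (i : Fin n → ℤ), IsDefect v N u i →
      ∃ i' : Fin n → ℤ, (∀ a, |i' a - i a| ≤ (R : ℤ)) ∧ C ≤ φ (shift i' u) := by
  by_contra! hcon
  have h0 : ∀ R : ℕ, ∃ u : Config n X, IsDefect v N u 0 ∧
      ∀ i : Fin n → ℤ, (∀ a, |i a| ≤ (R : ℤ)) → φ (shift i u) < 1 / ((R : ℝ) + 1) := by
    intro R
    obtain ⟨u, i, hd, hlt⟩ := hcon R (1 / ((R : ℝ) + 1)) (by positivity)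
    refine ⟨shift i u, hd.shift H1, fun i' hi' => ?_⟩
    rw [shift_shift]
    exact hlt _ fun a => by simpa using hi' a
  choose u hud hu using h0
  obtain ⟨M, M', C, hM, hMM', hC, hcoer⟩ := H2
  obtain ⟨c, hcs, hc0, hc⟩ := H3.exists_summable
  have hlim : Tendsto (fun R : ℕ => 1 / ((R : ℝ) + 1)) atTop (𝓝 0) :=
    tendsto_one_div_add_atTop_nhds_zero_nat
  -- eventually every site agrees with some ground state
  have hval : ∀ i : Fin n → ℤ, ∀ᶠ R in atTop, ∃ l, u R i = v l i := by
    intro i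
    obtain ⟨B, hB⟩ : ∃ B : ℕ, ∀ a, |i a| ≤ (B : ℤ) := by
      refine ⟨∑ a, (i a).natAbs, fun a => ?_⟩
      rw [Int.abs_eq_natAbs]
      exact_mod_cast Finset.single_le_sum (f := fun a => (i a).natAbs) (fun _ _ => Nat.zero_le _)
        (Finset.mem_univ a)
    filter_upwards [eventually_ge_atTop (B + M' * h), hlim.eventually_lt_const hC] with R hR hRC
    by_contra! hne
    -- When `u R i` matches no ground state, the centre `i` itself is the site of disagreement that
    -- (H2) asks for, for every `l`.
    obtain ⟨i', hi', hCi'⟩ := hcoer (u R) i fun l => ⟨i, fun a => by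
      have : (0 : ℝ) < M * h := by
        have : 0 < M * h := Nat.mul_pos (by omega) (by omega)
        exact_mod_cast this
      simpa using this, hne l⟩
    refine absurd (hu R i' fun a => ?_) (not_lt.2 (hRC.le.trans hCi'))
    have h1 := hi' a
    have h2 : |i' a - i a| ≤ ((M' * h : ℕ) : ℤ) := by
      have : ((|i' a - i a| : ℤ) : ℝ) ≤ ((M' * h : ℕ) : ℝ) := by
        push_cast at h1 ⊢
        have : (0 : ℝ) ≤ M' * h := by positivity
        linarith
      exact_mod_cast this
    have h3 : |i' a| ≤ |i' a - i a| + |i a| := by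
      simpa using abs_add_le (i' a - i a) (i a)
    have h4 : ((B + M' * h : ℕ) : ℤ) ≤ R := by exact_mod_cast hR
    have := hB a
    push_cast at *
    linarith
  -- This shows that `Fin K` is nonempty; `l₀` serves as the default label where no ground state
  -- matches.
  obtain ⟨R₀, l₀, -⟩ := (hval 0).exists
  have hg : ∀ R (i : Fin n → ℤ), ∃ l, (∃ l, u R i = v l i) → u R i = v l i := by
    intro R i
    by_cases hx : ∃ l, u R i = v l i
    · exact ⟨hx.choose, fun _ => hx.choose_spec⟩
    · exact ⟨l₀, fun hy => absurd hy hx⟩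
  choose g hg using hg
  obtain ⟨g', θ, hθ, hconv⟩ := CompactSpace.tendsto_subseq g
  rw [tendsto_pi_nhds] at hconv
  set w : Config n X := fun i => v (g' i) i with hw
  have hw1 : ∀ i, ∀ᶠ k in atTop, u (θ k) i = w i := by
    intro i
    have h1 := hconv i
    rw [nhds_discrete, tendsto_pure] at h1
    filter_upwards [h1, hθ.tendsto_atTop.eventually (hval i)] with k hk hk2
    rw [hg _ _ hk2]
    simp only [Function.comp] at hk
    rw [hk]
  have hw2 : ∀ (S : Set (Fin n → ℤ)), S.Finite → ∀ᶠ k in atTop, ∀ i ∈ S, u (θ k) i = w i :=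
    fun S hS => (Set.Finite.eventually_all hS).2 fun i _ => hw1 i
  have hw3 : ∀ i, φ (shift i w) = 0 := by
    intro i
    refine le_antisymm (le_of_forall_pos_le_add fun η hη => ?_) (hφ _)
    rw [zero_add]
    obtain ⟨m, hm1, hm2⟩ : ∃ m : ℕ, 1 ≤ m ∧ c m < η / 2 :=
      ((eventually_ge_atTop 1).and
        (hcs.tendsto_atTop_zero.eventually_lt_const (half_pos hη))).exists
    have hfin : {j : Fin n → ℤ | ∀ a, |j a - i a| ≤ (m : ℤ)}.Finite := finite_box _ _
    obtain ⟨B, hB⟩ : ∃ B : ℕ, ∀ a, |i a| ≤ (B : ℤ) := by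
      refine ⟨∑ a, (i a).natAbs, fun a => ?_⟩
      rw [Int.abs_eq_natAbs]
      exact_mod_cast Finset.single_le_sum (f := fun a => (i a).natAbs) (fun _ _ => Nat.zero_le _)
        (Finset.mem_univ a)
    obtain ⟨k, hk1, hk2, hk3⟩ := ((hw2 _ hfin).and
      ((hθ.tendsto_atTop.eventually (hlim.eventually_lt_const (half_pos hη))).and
        (hθ.tendsto_atTop.eventually (eventually_ge_atTop B)))).exists
    have h1 := hc m hm1 (shift i (u (θ k))) (shift i w) fun j hj => by
      refine hk1 _ fun a => ?_
      have h2 := hj a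
      simp only [Pi.zero_apply, sub_zero] at h2
      have : ((|j a| : ℤ) : ℝ) ≤ (m : ℝ) := by
        push_cast at h2 ⊢
        have : (0 : ℝ) ≤ m := by positivity
        linarith
      simpa using (by exact_mod_cast this : |j a| ≤ (m : ℤ))
    have h2 := hu (θ k) i fun a => (hB a).trans (by exact_mod_cast hk3)
    have h3 := (abs_le.1 h1).2
    linarith
  obtain ⟨l, hl⟩ := (H1 w).1 hw3
  obtain ⟨k, hk⟩ := (hw2 _ (finite_box (N : ℤ) 0)).exists
  obtain ⟨j, hj, hne⟩ := hud (θ k) l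
  exact hne ((hk j hj).trans (by rw [hl]))

/-! ### Defects control the translates of the phases -/

theorem energy_eq_tsum_indicator {n : ℕ} {X : Type*} (φ : Config n X → ℝ) (ε : ℝ)
    (u : Config n X) (Ω : Set (Space n)) :
    energy φ ε u Ω = ∑' i : Fin n → ℤ, {i | latticePoint ε i ∈ Ω}.indicator
      (fun i => ENNReal.ofReal (ε ^ (n - 1) * φ (shift i u))) i :=
  tsum_subtype {i : Fin n → ℤ | latticePoint ε i ∈ Ω}
    (fun i => ENNReal.ofReal (ε ^ (n - 1) * φ (shift i u)))

/-- Every defect charges a site at an offset in the box of radius `R`, so a site is charged at most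
`(2 * R + 1) ^ n` times. The margin `η` keeps the charged site in `Ω`. -/
theorem tsum_defect_le {n K : ℕ} {X : Type*} {φ : Config n X → ℝ} {v : Fin K → Config n X}
    {N R : ℕ} {C : ℝ} (hdef : ∀ (u : Config n X) (i : Fin n → ℤ), IsDefect v N u i →
      ∃ i' : Fin n → ℤ, (∀ a, |i' a - i a| ≤ (R : ℤ)) ∧ C ≤ φ (shift i' u))
    (Ω : Set (Space n)) {ε η : ℝ} (hε : 0 < ε) (hη : n * (ε * R) ≤ η) (u : Config n X) :
    ∑' _ : {i | latticePoint ε i ∈ innerSet Ω η ∧ IsDefect v N u i},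
      ENNReal.ofReal (ε ^ (n - 1) * C) ≤ ((2 * R + 1) ^ n : ℕ) * energy φ ε u Ω := by
  set G : (Fin n → ℤ) → ℝ≥0∞ := {i | latticePoint ε i ∈ Ω}.indicator
      (fun i => ENNReal.ofReal (ε ^ (n - 1) * φ (shift i u))) with hG
  set B : Finset (Fin n → ℤ) := Fintype.piFinset fun _ => Finset.Icc (-(R : ℤ)) R with hB
  have hBcard : B.card = (2 * R + 1) ^ n := by
    rw [hB, Fintype.card_piFinset_const, Int.card_Icc]
    congr 1
    omega
  set S := {i | latticePoint ε i ∈ innerSet Ω η ∧ IsDefect v N u i} with hS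
  calc ∑' _ : S, ENNReal.ofReal (ε ^ (n - 1) * C)
      ≤ ∑' i : S, ∑ r ∈ B, G (i.1 + r) := by
        refine ENNReal.tsum_le_tsum fun i => ?_
        obtain ⟨i', hi', hC⟩ := hdef u i.1 i.2.2
        have hr : i' - i.1 ∈ B := by
          rw [hB, Fintype.mem_piFinset]
          intro a
          rw [Finset.mem_Icc]
          exact abs_le.1 (hi' a)
        refine le_trans ?_ (Finset.single_le_sum (f := fun r => G (i.1 + r))
          (fun _ _ => zero_le) hr)
        have hmem : latticePoint ε i' ∈ Ω := by
          refine innerSet_subset (mem_innerSet_of_dist_le (δ' := 0) (r := η) le_rfl (by simp) i.2.1 ?_)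
          refine (dist_latticePoint_le hε.le (r := R) fun a => ?_).trans hη
          rw [← neg_sub, Int.cast_neg, abs_neg]
          exact_mod_cast hi' a
        rw [show i.1 + (i' - i.1) = i' by abel, hG, indicator_of_mem (by exact hmem)]
        gcongr
    _ = ∑ r ∈ B, ∑' i : S, G (i.1 + r) :=
        Summable.tsum_finsetSum fun r _ => ENNReal.summable
    _ ≤ ∑ r ∈ B, energy φ ε u Ω := by
        refine Finset.sum_le_sum fun r _ => ?_
        rw [energy_eq_tsum_indicator, ← (Equiv.addRight r).tsum_eq G]
        exact ENNReal.tsum_comp_le_tsum_of_injective Subtype.val_injective (fun i => G (i + r))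
    _ = ((2 * R + 1) ^ n : ℕ) * energy φ ε u Ω := by
        rw [Finset.sum_const, hBcard, nsmul_eq_mul]

/-- The lattice points of the cell of `y` lie within `h + 2` of the site of `x`: `h` for the side of
the cell, 1 for moving from `y` to `x`, and 1 for rounding. So near a site that is not a defect the
same single phase is seen everywhere. -/
theorem exists_mem_phase_iff_of_not_isDefect {n K h : ℕ} (hh : 1 ≤ h) {X : Type*}
    {v : Fin K → Config n X} (hv_inj : Function.Injective v) (hv_per : ∀ l, IsPeriodic h (v l))
    {ε : ℝ} (hε : 0 < ε) {u : Config n X} {x : Space n}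
    (hx : ¬ IsDefect v (h + 2) u (site ε x)) :
    ∃ l₀, ∀ y : Space n, (∀ a, |y a - x a| ≤ ε) → ∀ l, y ∈ phase h (v l) ε u ↔ l = l₀ := by
  simp only [IsDefect, not_forall, not_exists, not_and, ne_eq, not_not] at hx
  obtain ⟨l₀, hl₀⟩ := hx
  refine ⟨l₀, fun y hy l => ?_⟩
  have key : ∀ j : Fin n → ℤ, InCell h (cellIndex h ε y) (fun a => (j a : ℝ)) →
      u j = v l₀ j := by
    intro j hj
    refine hl₀ j fun a => ?_
    have h1 := hj a
    have h2 := inCell_cellIndex hh ε y a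
    have h3 := (site_eq_iff hε x _).1 rfl a
    have h4 : |y a / ε - x a / ε| ≤ 1 := by
      rw [← sub_div, abs_div, abs_of_pos hε, div_le_one hε]; exact hy a
    have h5 : (site ε x a : ℝ) ≤ x a / ε := Int.floor_le _
    have h6 : x a / ε < site ε x a + 1 := Int.lt_floor_add_one _
    have h7 := abs_le.1 h4
    have : |((j a - site ε x a : ℤ) : ℝ)| ≤ ((h + 2 : ℕ) : ℝ) := by
      push_cast
      rw [abs_le]
      constructor <;> linarith
    exact_mod_cast this
  rw [mem_phase_iff hh hε]
  constructor
  · intro hl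
    refine hv_inj ((hv_per l).eq_of_eqOn_cell hh (hv_per l₀) (cellIndex h ε y) fun j hj => ?_)
    rw [← hl j hj, key j hj]
  · rintro rfl
    exact key

theorem disjoint_phase {n K h : ℕ} (hh : 1 ≤ h) {X : Type*}
    {v : Fin K → Config n X} (hv_inj : Function.Injective v) (hv_per : ∀ l, IsPeriodic h (v l))
    {ε : ℝ} (hε : 0 < ε) (u : Config n X) {l l' : Fin K} (hl : l ≠ l') :
    Disjoint (phase h (v l) ε u) (phase h (v l') ε u) := by
  rw [Set.disjoint_left]
  intro x hx hx'
  rw [mem_phase_iff hh hε] at hx hx'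
  refine hl (hv_inj ((hv_per l).eq_of_eqOn_cell hh (hv_per l') (cellIndex h ε x) fun j hj => ?_))
  rw [← hx j hj, hx' j hj]

/-- The volume estimates on the phases in terms of the energy: the phases almost fill the domain,
and they differ little from their translates. -/
theorem exists_volume_le_energy {n K h : ℕ} (hn : 1 ≤ n) (hh : 1 ≤ h) {X : Type*}
    {φ : Config n X → ℝ} (hφ : ∀ u, 0 ≤ φ u) {v : Fin K → Config n X}
    (hv_inj : Function.Injective v) (hv_per : ∀ l, IsPeriodic h (v l))
    (H1 : GroundStates φ v) (H2 : Coercive φ h v) (H3 : MildlyNonlocal φ) :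
    ∃ (R : ℕ) (C : ℝ≥0∞), C ≠ ⊤ ∧ ∀ (Ω : Set (Space n)) (ε η : ℝ), 0 < ε → 0 < η →
      n * (ε * R) ≤ η → n * ε ≤ η / 2 → ∀ u : Config n X,
      volume {x | x ∈ innerSet Ω (2 * η) ∧ ∀ l, x ∉ phase h (v l) ε u}
        ≤ C * ENNReal.ofReal ε * energy φ ε u Ω ∧
      ∀ τ : Space n, ‖τ‖ ≤ η / 2 →
      volume {x | x ∈ innerSet Ω (2 * η) ∧
          ∃ l, ¬ (x ∈ phase h (v l) ε u ↔ x + τ ∈ phase h (v l) ε u)}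
        ≤ C * ENNReal.ofReal (‖τ‖ + 3 * ε) * energy φ ε u Ω := by
  obtain ⟨R, C, hC, hdef⟩ := exists_energy_of_isDefect hh hφ H1 H2 H3 (h + 2)
  have hC' : ENNReal.ofReal C ≠ 0 := by simpa using hC
  refine ⟨R, (ENNReal.ofReal C)⁻¹ * ((2 * R + 1) ^ n : ℕ), ?_, ?_⟩
  · exact ENNReal.mul_ne_top (ENNReal.inv_ne_top.2 hC') (ENNReal.natCast_ne_top _)
  intro Ω ε η hε hη hR hηε u
  set S := {i | latticePoint ε i ∈ innerSet Ω η ∧ IsDefect v (h + 2) u i} with hS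
  have hvol : volume {x : Space n | site ε x ∈ S}
      ≤ ENNReal.ofReal ε * ((ENNReal.ofReal C)⁻¹ * ((2 * R + 1) ^ n : ℕ) * energy φ ε u Ω) := by
    refine (volume_site_preimage_le hε S).trans ?_
    have h1 : ∑' _ : S, ENNReal.ofReal ε ^ n
        = ENNReal.ofReal ε * ((ENNReal.ofReal C)⁻¹ *
          ∑' _ : S, ENNReal.ofReal (ε ^ (n - 1) * C)) := by
      rw [← ENNReal.tsum_mul_left, ← ENNReal.tsum_mul_left]
      congr 1
      funext i
      rw [ENNReal.ofReal_mul (by positivity), mul_comm (ENNReal.ofReal (ε ^ (n - 1))), ← mul_assoc,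
        ← mul_assoc, mul_assoc (ENNReal.ofReal ε),
        ENNReal.inv_mul_cancel hC' ENNReal.ofReal_ne_top, mul_one,
        ENNReal.ofReal_pow hε.le, ← pow_succ', Nat.sub_add_cancel hn]
    rw [h1, mul_assoc (ENNReal.ofReal C)⁻¹]
    gcongr
    exact tsum_defect_le hdef Ω hε hR u
  have hmeas : MeasurableSet {x : Space n | site ε x ∈ S} :=
    measurable_site ε MeasurableSet.of_discrete
  have hgood : ∀ x, x ∈ innerSet Ω (3 / 2 * η) → site ε x ∉ S →
      ¬ IsDefect v (h + 2) u (site ε x) := by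
    intro x hx hxS hd
    refine hxS ⟨mem_innerSet_of_dist_le hη.le (r := η / 2) (by linarith) hx ?_, hd⟩
    exact (dist_latticePoint_site hε x).trans hηε
  constructor
  · calc _ ≤ volume {x : Space n | site ε x ∈ S} := by
          refine measure_mono fun x hx => ?_
          by_contra hxS
          obtain ⟨l₀, hl₀⟩ := exists_mem_phase_iff_of_not_isDefect hh hv_inj hv_per hε
            (hgood x (innerSet_anti (by linarith) hx.1) hxS)
          exact hx.2 l₀ ((hl₀ x (fun a => by simpa using hε.le) l₀).2 rfl)
      _ ≤ _ := hvol.trans (le_of_eq (by ring))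
  intro τ hτ
  -- The translation is split into `P` steps of length at most `ε`; the extra 1 keeps `P` positive
  -- when `τ = 0`.
  set P : ℕ := ⌈‖τ‖ / ε⌉₊ + 1 with hP
  have hPpos : (0 : ℝ) < P := by positivity
  have hPτ : ‖τ‖ / P ≤ ε := by
    rw [div_le_iff₀ hPpos, ← div_le_iff₀' hε]
    have := Nat.le_ceil (‖τ‖ / ε)
    rw [hP]; push_cast; linarith
  -- If membership in a phase differs at the two ends of the segment, it changes during one of the
  -- steps, and the site where that step starts is a defect.
  have hsub : {x | x ∈ innerSet Ω (2 * η) ∧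
          ∃ l, ¬ (x ∈ phase h (v l) ε u ↔ x + τ ∈ phase h (v l) ε u)}
      ⊆ ⋃ m ∈ Finset.range P, (fun x : Space n => x + ((m : ℝ) / P) • τ) ⁻¹'
        {x : Space n | site ε x ∈ S} := by
    rintro x ⟨hx, l, hl⟩
    by_contra hcon
    simp only [mem_iUnion, not_exists, Finset.mem_range] at hcon
    have step : ∀ m : ℕ, m ≤ P →
        (x ∈ phase h (v l) ε u ↔ x + ((m : ℝ) / P) • τ ∈ phase h (v l) ε u) := by
      intro m
      induction m with
      | zero => simp
      | succ m ih =>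
        intro hm
        rw [ih (by omega)]
        have hin : x + ((m : ℝ) / P) • τ ∈ innerSet Ω (3 / 2 * η) := by
          refine mem_innerSet_of_dist_le (by positivity) (r := η / 2) (by linarith) hx ?_
          rw [dist_self_add_right, norm_smul, Real.norm_of_nonneg (by positivity)]
          have : (m : ℝ) / P ≤ 1 := by
            rw [div_le_one hPpos]; exact_mod_cast (by omega : m ≤ P)
          exact (mul_le_of_le_one_left (norm_nonneg _) this).trans hτ
        obtain ⟨l₀, hl₀⟩ := exists_mem_phase_iff_of_not_isDefect hh hv_inj hv_per hε
          (hgood _ hin (hcon m (by omega)))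
        rw [hl₀ _ (fun a => by simpa using hε.le), hl₀]
        intro a
        have : x + (((m + 1 : ℕ) : ℝ) / P) • τ = x + ((m : ℝ) / P) • τ + (1 / P : ℝ) • τ := by
          rw [add_assoc, ← add_smul]; push_cast; congr 2; ring
        rw [this, PiLp.add_apply, add_sub_cancel_left, PiLp.smul_apply, smul_eq_mul, abs_mul,
          abs_of_nonneg (by positivity), one_div_mul_eq_div]
        refine le_trans ?_ hPτ
        gcongr
        exact abs_coord_le_norm τ a
    have := step P le_rfl
    rw [div_self hPpos.ne', one_smul] at this
    exact hl this
  refine (measure_mono hsub).trans ((measure_biUnion_finset_le _ _).trans ?_)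
  simp only [measure_preimage_add_right]
  rw [Finset.sum_const, Finset.card_range, nsmul_eq_mul]
  calc (P : ℝ≥0∞) * volume {x : Space n | site ε x ∈ S}
      ≤ P * (ENNReal.ofReal ε * ((ENNReal.ofReal C)⁻¹ * ((2 * R + 1) ^ n : ℕ)
        * energy φ ε u Ω)) := by gcongr
    _ = (ENNReal.ofReal C)⁻¹ * ((2 * R + 1) ^ n : ℕ) * (P * ENNReal.ofReal ε)
        * energy φ ε u Ω := by ring
    _ ≤ _ := by
      gcongr
      rw [← ENNReal.ofReal_natCast, ← ENNReal.ofReal_mul (by positivity)]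
      apply ENNReal.ofReal_le_ofReal
      have := (Nat.ceil_lt_add_one (div_nonneg (norm_nonneg τ) hε.le)).le
      have e : ‖τ‖ = ‖τ‖ / ε * ε := by field_simp
      rw [e, hP]
      push_cast
      have : (⌈‖τ‖ / ε * ε / ε⌉₊ : ℝ) = ⌈‖τ‖ / ε⌉₊ := by rw [← e]
      nlinarith

/-! ### Compactness of sequences of sets with controlled translates -/

/-- Average over the offset `y` in a cube of side `ρ`. For fixed `x` the displacement from `x` to
its sample point ranges over a cube contained in [-ρ, ρ)ⁿ, so by Fubini the average is at most `B
(2ρ)ⁿ / ρⁿ`. On `G` the set `E` is thus close to a union of grid cubes, each decided by one sample.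
-/
theorem exists_sample_point {n : ℕ} {E G : Set (Space n)} (hE : MeasurableSet E)
    (hG : MeasurableSet G) {ρ : ℝ} (hρ : 0 < ρ) {B : ℝ≥0∞}
    (hB : ∀ τ : Space n, ‖τ‖ ≤ n * ρ → volume {x | x ∈ G ∧ ¬ (x ∈ E ↔ x + τ ∈ E)} ≤ B) :
    ∃ y : Space n, volume {x | x ∈ G ∧ ¬ (x ∈ E ↔ y + latticePoint ρ (site ρ x) ∈ E)}
      ≤ 2 ^ n * B := by
  set Y : Set (Space n) := {y | ∀ a, (0 : ℝ) ≤ y a ∧ y a < 0 + ρ} with hY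
  set W : Set (Space n) := {y | ∀ a, -ρ ≤ y a ∧ y a < -ρ + 2 * ρ} with hW
  have hYm : MeasurableSet Y := measurableSet_box (fun _ => 0) ρ
  have hWm : MeasurableSet W := measurableSet_box (fun _ => -ρ) (2 * ρ)
  have hYv : volume Y = ENNReal.ofReal ρ ^ n := volume_box (fun _ => 0) ρ
  have hWv : volume W = ENNReal.ofReal (2 * ρ) ^ n := volume_box (fun _ => -ρ) (2 * ρ)
  have hρ0 : ENNReal.ofReal ρ ^ n ≠ 0 := pow_ne_zero _ (by simpa using hρ)
  have hρt : ENNReal.ofReal ρ ^ n ≠ ⊤ := ENNReal.pow_ne_top ENNReal.ofReal_ne_top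
  have hq : Measurable fun x : Space n => latticePoint ρ (site ρ x) :=
    (measurable_of_countable (latticePoint ρ)).comp (measurable_site ρ)
  have hiff : ∀ (s t : Set (Space n × Space n)), MeasurableSet s → MeasurableSet t →
      MeasurableSet {p | ¬ (p ∈ s ↔ p ∈ t)} := by
    intro s t hs ht
    have : {p | ¬ (p ∈ s ↔ p ∈ t)} = symmDiff s t := by
      ext p; simp only [mem_ofPred_eq, mem_symmDiff]; tauto
    rw [this]
    exact hs.symmDiff ht
  set T : Set (Space n × Space n) := {p | p.1 ∈ G ∧ p.2 ∈ Y ∧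
    ¬ (p.1 ∈ E ↔ p.2 + latticePoint ρ (site ρ p.1) ∈ E)} with hT
  set T' : Set (Space n × Space n) := {p | p.1 ∈ G ∧ p.2 ∈ W ∧
    ¬ (p.1 ∈ E ↔ p.1 + p.2 ∈ E)} with hT'
  have hTm : MeasurableSet T :=
    (measurable_fst hG).inter ((measurable_snd hYm).inter
      (hiff _ _ (measurable_fst hE) ((measurable_snd.add (hq.comp measurable_fst)) hE)))
  have hTm' : MeasurableSet T' :=
    (measurable_fst hG).inter ((measurable_snd hWm).inter
      (hiff _ _ (measurable_fst hE) ((measurable_fst.add measurable_snd) hE)))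
  have h1 : (volume.prod volume) T ≤ (volume.prod volume) T' := by
    rw [Measure.prod_apply hTm, Measure.prod_apply hTm']
    refine lintegral_mono fun x => ?_
    rw [← measure_preimage_add_right volume (latticePoint ρ (site ρ x) - x) (Prod.mk x ⁻¹' T')]
    refine measure_mono fun y hy => ?_
    obtain ⟨hx, hyY, hne⟩ := hy
    refine ⟨hx, fun a => ?_, ?_⟩
    · have h1 := hyY a
      have h2 := (site_eq_iff hρ x _).1 rfl a
      simp only [PiLp.add_apply, PiLp.sub_apply, latticePoint]
      simp only at h1
      constructor <;> linarith
    · simp only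
      rwa [show x + (y + (latticePoint ρ (site ρ x) - x)) = y + latticePoint ρ (site ρ x) by abel]
  have h2 : (volume.prod volume) T' ≤ B * ENNReal.ofReal (2 * ρ) ^ n := by
    rw [Measure.prod_apply_symm hTm', ← hWv, ← setLIntegral_const, ← lintegral_indicator hWm]
    refine lintegral_mono fun τ => ?_
    by_cases hτ : τ ∈ W
    · rw [indicator_of_mem hτ]
      refine le_trans (measure_mono ?_) (hB τ ?_)
      · exact fun x hx => ⟨hx.1, hx.2.2⟩
      · have := dist_le_mul_of_coord (x := τ) (y := 0) (r := ρ) fun a => by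
          have := hτ a
          simp only [PiLp.zero_apply, sub_zero]
          rw [abs_le]; constructor <;> linarith
        simpa using this
    · rw [indicator_of_notMem hτ, nonpos_iff_eq_zero]
      convert measure_empty (μ := volume)
      ext x
      simp only [mem_preimage, mem_empty_iff_false, iff_false]
      exact fun hx => hτ hx.2.1
  have hfm : Measurable fun y => volume ((fun x => (x, y)) ⁻¹' T) := measurable_measure_prodMk_right hTm
  obtain ⟨y, hyY, hy⟩ := exists_le_setLAverage (μ := volume) (s := Y) (by rw [hYv]; exact hρ0)
    (by rw [hYv]; exact hρt) hfm.aemeasurable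
  refine ⟨y, ?_⟩
  have e1 : {x | x ∈ G ∧ ¬ (x ∈ E ↔ y + latticePoint ρ (site ρ x) ∈ E)}
      = (fun x => (x, y)) ⁻¹' T := by
    ext x
    exact ⟨fun hx => ⟨hx.1, hyY, hx.2⟩, fun hx => ⟨hx.1, hx.2.2⟩⟩
  rw [e1]
  refine hy.trans ?_
  rw [setLAverage_eq, hYv]
  refine ENNReal.div_le_of_le_mul ?_
  calc ∫⁻ y in Y, volume ((fun x => (x, y)) ⁻¹' T)
      ≤ ∫⁻ y, volume ((fun x => (x, y)) ⁻¹' T) := setLIntegral_le_lintegral _ _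
    _ = (volume.prod volume) T := (Measure.prod_apply_symm hTm).symm
    _ ≤ B * ENNReal.ofReal (2 * ρ) ^ n := h1.trans h2
    _ = 2 ^ n * B * ENNReal.ofReal ρ ^ n := by
      rw [ENNReal.ofReal_mul (by norm_num), mul_pow]
      simp only [ENNReal.ofReal_ofNat]
      ring

theorem finite_site_image {n : ℕ} {ρ : ℝ} (hρ : 0 < ρ) {G : Set (Space n)}
    (hG : Bornology.IsBounded G) : (site ρ '' G).Finite := by
  obtain ⟨r, hr⟩ := hG.exists_norm_le
  refine (Set.Finite.pi' fun _ : Fin n => Set.finite_Icc (⌊-r / ρ⌋) (⌊r / ρ⌋)).subset ?_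
  rintro _ ⟨x, hx, rfl⟩ a
  have h1 := abs_le.1 ((abs_coord_le_norm x a).trans (hr x hx))
  constructor
  · apply Int.floor_le_floor
    gcongr
    exact h1.1
  · apply Int.floor_le_floor
    gcongr
    exact h1.2

/-- Total boundedness in L¹ on `G`, as in the Fréchet–Kolmogorov criterion. At a small scale `ρ`
each `E j` is, up to `η / 2`, coded by its samples on the finitely many grid cubes meeting `G`.
There are finitely many codes, and the ultrafilter selects one. Working with one ultrafilter allows
the index sets for different scales and phases to be intersected. -/
theorem exists_mem_ultrafilter_volume_symmDiff_le {n : ℕ} {G : Set (Space n)}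
    (hG : MeasurableSet G) (hGb : Bornology.IsBounded G) {E : ℕ → Set (Space n)}
    (hE : ∀ j, MeasurableSet (E j)) {C : ℝ≥0∞} (hC : C ≠ ⊤) {r : ℝ} (hr : 0 < r)
    {e : ℕ → ℝ} (he : Tendsto e atTop (𝓝 0))
    (h : ∀ᶠ j in atTop, ∀ τ : Space n, ‖τ‖ ≤ r →
      volume {x | x ∈ G ∧ ¬ (x ∈ E j ↔ x + τ ∈ E j)} ≤ C * ENNReal.ofReal (‖τ‖ + e j))
    (U : Ultrafilter ℕ) (hU : (U : Filter ℕ) ≤ atTop) {η : ℝ≥0∞} (hη : η ≠ 0) :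
    ∃ S ∈ U, ∀ i ∈ S, ∀ j ∈ S, volume (symmDiff (E i) (E j) ∩ G) ≤ η := by
  obtain ⟨ρ, hρ, hρr, hρη⟩ : ∃ ρ : ℝ, 0 < ρ ∧ n * ρ ≤ r ∧
      2 ^ n * (C * ENNReal.ofReal (n * ρ + ρ)) ≤ η / 2 := by
    have h1 : Tendsto (fun ρ : ℝ => (n : ℝ) * ρ) (𝓝[>] 0) (𝓝 0) := by
      have : Tendsto (fun ρ : ℝ => (n : ℝ) * ρ) (𝓝 0) (𝓝 (n * 0)) :=
        (continuous_const.mul continuous_id).tendsto 0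
      rw [mul_zero] at this
      exact this.mono_left nhdsWithin_le_nhds
    have h2 : Tendsto (fun ρ : ℝ => 2 ^ n * (C * ENNReal.ofReal (n * ρ + ρ))) (𝓝[>] 0) (𝓝 0) := by
      have h3 : Tendsto (fun ρ : ℝ => ENNReal.ofReal (n * ρ + ρ)) (𝓝 0)
          (𝓝 (ENNReal.ofReal (n * 0 + 0))) :=
        (ENNReal.continuous_ofReal.comp
          ((continuous_const.mul continuous_id).add continuous_id)).tendsto 0
      have h4 := ENNReal.Tendsto.const_mul (a := 2 ^ n)
        (ENNReal.Tendsto.const_mul (a := C) h3 (Or.inr hC))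
        (Or.inr (ENNReal.pow_ne_top (by norm_num)))
      simp only [mul_zero, add_zero, ENNReal.ofReal_zero] at h4
      exact h4.mono_left nhdsWithin_le_nhds
    obtain ⟨ρ, h5, h6, h7⟩ := ((eventually_mem_nhdsWithin (a := (0 : ℝ)) (s := Ioi 0)).and
      ((h1.eventually_le_const hr).and
        (h2.eventually_le_const (ENNReal.half_pos hη)))).exists
    exact ⟨ρ, h5, h6, h7⟩
  have hev : ∀ᶠ j in atTop, ∃ y : Space n,
      volume {x | x ∈ G ∧ ¬ (x ∈ E j ↔ y + latticePoint ρ (site ρ x) ∈ E j)} ≤ η / 2 := by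
    filter_upwards [h, he.eventually_le_const hρ] with j hj hej
    obtain ⟨y, hy⟩ := exists_sample_point (hE j) hG hρ
      (B := C * ENNReal.ofReal (n * ρ + ρ)) fun τ hτ => by
        refine (hj τ (hτ.trans hρr)).trans ?_
        gcongr
    exact ⟨y, hy.trans hρη⟩
  have hF := finite_site_image hρ hGb
  -- Indices without a good offset get the offset 0; they lie outside a member of `U`.
  have hy : ∀ j, ∃ y : Space n, (∃ y : Space n,
      volume {x | x ∈ G ∧ ¬ (x ∈ E j ↔ y + latticePoint ρ (site ρ x) ∈ E j)} ≤ η / 2) →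
      volume {x | x ∈ G ∧ ¬ (x ∈ E j ↔ y + latticePoint ρ (site ρ x) ∈ E j)} ≤ η / 2 := by
    intro j
    by_cases hx : ∃ y : Space n,
      volume {x | x ∈ G ∧ ¬ (x ∈ E j ↔ y + latticePoint ρ (site ρ x) ∈ E j)} ≤ η / 2
    · exact ⟨hx.choose, fun _ => hx.choose_spec⟩
    · exact ⟨0, fun hx' => absurd hx' hx⟩
  choose y hy using hy
  set col : ℕ → Set (Fin n → ℤ) := fun j => {i | i ∈ site ρ '' G ∧ y j + latticePoint ρ i ∈ E j}
    with hcol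
  obtain ⟨c, -, hc⟩ := Ultrafilter.eq_pure_of_finite_mem (f := U.map col)
    (s := {s | s ⊆ site ρ '' G}) hF.finite_subsets (by
      rw [Ultrafilter.mem_map]
      exact Filter.univ_mem' fun j i hi => hi.1)
  have hS1 : col ⁻¹' {c} ∈ U := by
    rw [← Ultrafilter.mem_map, hc]
    exact mem_singleton c
  have hS2 : {j | ∃ y : Space n,
      volume {x | x ∈ G ∧ ¬ (x ∈ E j ↔ y + latticePoint ρ (site ρ x) ∈ E j)} ≤ η / 2} ∈ U :=
    hU hev
  refine ⟨_, Filter.inter_mem hS1 hS2, fun i hi j hj => ?_⟩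
  have hij : col i = col j := hi.1.trans hj.1.symm
  calc volume (symmDiff (E i) (E j) ∩ G)
      ≤ volume ({x | x ∈ G ∧ ¬ (x ∈ E i ↔ y i + latticePoint ρ (site ρ x) ∈ E i)}
          ∪ {x | x ∈ G ∧ ¬ (x ∈ E j ↔ y j + latticePoint ρ (site ρ x) ∈ E j)}) := by
        refine measure_mono ?_
        rintro x ⟨hx, hxG⟩
        have h1 : (y i + latticePoint ρ (site ρ x) ∈ E i ↔
            y j + latticePoint ρ (site ρ x) ∈ E j) := by
          have h2 : site ρ x ∈ col i ↔ site ρ x ∈ col j := by rw [hij]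
          have h3 : site ρ x ∈ site ρ '' G := ⟨x, hxG, rfl⟩
          exact ⟨fun h4 => (h2.1 ⟨h3, h4⟩).2, fun h4 => (h2.2 ⟨h3, h4⟩).2⟩
        rw [mem_symmDiff] at hx
        simp only [mem_union, mem_ofPred_eq]
        tauto
    _ ≤ η / 2 + η / 2 := (measure_union_le _ _).trans (add_le_add (hy i hi.2) (hy j hj.2))
    _ = η := ENNReal.add_halves η

/-- A point on which `E j` and the limsup set disagree must change membership between two
consecutive later sets, so the difference is bounded by the tail of a geometric series. -/
theorem tendsto_volume_symmDiff_limsup {α : Type*} [MeasurableSpace α] (μ : Measure α) (G : Set α)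
    {E : ℕ → Set α} (h : ∀ j, μ (symmDiff (E j) (E (j + 1)) ∩ G) ≤ 2⁻¹ ^ j) :
    Tendsto (fun j => μ (symmDiff (E j) (⋂ N, ⋃ i, E (N + i)) ∩ G)) atTop (𝓝 0) := by
  have hle : ∀ j, μ (symmDiff (E j) (⋂ N, ⋃ i, E (N + i)) ∩ G) ≤ 2⁻¹ ^ j * 2 := by
    intro j
    have hsub : symmDiff (E j) (⋂ N, ⋃ i, E (N + i)) ∩ G
        ⊆ ⋃ i, symmDiff (E (j + i)) (E (j + i + 1)) ∩ G := by
      rintro x ⟨hx, hxG⟩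
      by_contra hcon
      simp only [mem_iUnion, mem_inter_iff, hxG, and_true, not_exists, mem_symmDiff] at hcon
      have hconst : ∀ i, x ∈ E (j + i) ↔ x ∈ E j := by
        intro i
        induction i with
        | zero => simp
        | succ i ih =>
          rw [← ih, ← add_assoc]
          have := hcon i
          tauto
      rw [mem_symmDiff] at hx
      simp only [mem_iInter, mem_iUnion] at hx
      rcases hx with ⟨h1, h2⟩ | ⟨h1, h2⟩
      · exact h2 fun N => ⟨j, by rw [add_comm]; exact (hconst N).2 h1⟩
      · obtain ⟨i, hi⟩ := h1 j
        exact h2 ((hconst i).1 hi)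
    calc _ ≤ ∑' i, μ (symmDiff (E (j + i)) (E (j + i + 1)) ∩ G) :=
          (measure_mono hsub).trans (measure_iUnion_le _)
      _ ≤ ∑' i, (2⁻¹ : ℝ≥0∞) ^ j * 2⁻¹ ^ i :=
          ENNReal.tsum_le_tsum fun i => (h (j + i)).trans_eq (pow_add _ _ _)
      _ = 2⁻¹ ^ j * 2 := by
          rw [ENNReal.tsum_mul_left, ENNReal.tsum_geometric, ENNReal.one_sub_inv_two, inv_inv]
  have hlim : Tendsto (fun j : ℕ => (2⁻¹ : ℝ≥0∞) ^ j * 2) atTop (𝓝 0) := by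
    have h1 : Tendsto (fun j : ℕ => (2⁻¹ : ℝ≥0∞) ^ j) atTop (𝓝 0) :=
      ENNReal.tendsto_pow_atTop_nhds_zero_of_lt_one (by simp)
    have := ENNReal.Tendsto.mul_const (b := 2) h1 (Or.inr (by norm_num))
    simpa using this
  exact tendsto_of_tendsto_of_tendsto_of_le_of_le tendsto_const_nhds hlim (fun _ => zero_le) hle

theorem exists_subseq_tendsto_of_translates {n K : ℕ} {G : Set (Space n)}
    (hG : MeasurableSet G) (hGb : Bornology.IsBounded G) {E : ℕ → Fin K → Set (Space n)}
    (hE : ∀ j l, MeasurableSet (E j l)) {C : ℝ≥0∞} (hC : C ≠ ⊤) {r : ℝ} (hr : 0 < r)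
    {e : ℕ → ℝ} (he : Tendsto e atTop (𝓝 0))
    (h : ∀ᶠ j in atTop, ∀ τ : Space n, ‖τ‖ ≤ r → ∀ l,
      volume {x | x ∈ G ∧ ¬ (x ∈ E j l ↔ x + τ ∈ E j l)} ≤ C * ENNReal.ofReal (‖τ‖ + e j)) :
    ∃ θ : ℕ → ℕ, StrictMono θ ∧ ∃ A : Fin K → Set (Space n), (∀ l, MeasurableSet (A l)) ∧
      ∀ l, Tendsto (fun j => volume (symmDiff (E (θ j) l) (A l) ∩ G)) atTop (𝓝 0) := by
  set U : Ultrafilter ℕ := Filter.hyperfilter ℕ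
  have hU : (U : Filter ℕ) ≤ atTop := Nat.hyperfilter_le_atTop
  have hS : ∀ m : ℕ, ∃ S ∈ U, ∀ l, ∀ i ∈ S, ∀ j ∈ S,
      volume (symmDiff (E i l) (E j l) ∩ G) ≤ 2⁻¹ ^ m := by
    intro m
    have : ∀ l, ∃ S ∈ U, ∀ i ∈ S, ∀ j ∈ S,
        volume (symmDiff (E i l) (E j l) ∩ G) ≤ 2⁻¹ ^ m := fun l =>
      exists_mem_ultrafilter_volume_symmDiff_le hG hGb (fun j => hE j l) hC hr he
        (h.mono fun j hj τ hτ => hj τ hτ l) U hU (by simp)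
    choose S hSU hS using this
    refine ⟨⋂ l, S l, Filter.iInter_mem.2 hSU, fun l i hi j hj => hS l i ?_ j ?_⟩
    · exact mem_iInter.1 hi l
    · exact mem_iInter.1 hj l
  choose S hSU hS using hS
  -- Asking for membership in `S i` for all `i ≤ m` puts the consecutive terms `θ m` and `θ (m + 1)`
  -- in the common set `S m`.
  obtain ⟨θ, hθ, hθS⟩ := extraction_forall_of_frequently (P := fun m k => ∀ i ≤ m, k ∈ S i)
    (fun m => by
      have h1 : ∀ᶠ k in (U : Filter ℕ), ∀ i ≤ m, k ∈ S i := by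
        have := (Set.Finite.eventually_all (l := (U : Filter ℕ)) (Set.finite_Iic m)
          (p := fun i k => k ∈ S i)).2 fun i _ => hSU i
        exact this
      exact h1.frequently.filter_mono hU)
  refine ⟨θ, hθ, fun l => ⋂ N, ⋃ i, E (θ (N + i)) l, fun l => ?_, fun l => ?_⟩
  · exact MeasurableSet.iInter fun N => MeasurableSet.iUnion fun i => hE _ _
  · exact tendsto_volume_symmDiff_limsup volume G (E := fun j => E (θ j) l) fun j =>
      hS j l _ (hθS j j le_rfl) _ (hθS (j + 1) j (Nat.le_succ j))

/-! ### Finite perimeter from the estimates on the translates -/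

/-- The difference quotient is moved from `S` onto the indicator of `A` by a change of variable.
There it is nonzero only where `A` differs from its translate by a vector of length at most `t`, and
on `G` that set has measure at most `B t`, which cancels the factor `1 / t`. -/
theorem setIntegral_lineDeriv_le_of_translates {n : ℕ} {A G : Set (Space n)}
    (hA : NullMeasurableSet A volume) {B r : ℝ} (hB0 : 0 ≤ B) (hr : 0 < r)
    (hB : ∀ τ : Space n, ‖τ‖ ≤ r →
      volume {x | x ∈ G ∧ ¬ (x ∈ A ↔ x + τ ∈ A)} ≤ ENNReal.ofReal (B * ‖τ‖))
    {S : Space n → ℝ} (hS : ContDiff ℝ 1 S) (hSc : HasCompactSupport S)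
    (hS1 : ∀ x, |S x| ≤ 1) (hSG : ∀ x, S x ≠ 0 → x ∈ G) {e : Space n} (he : ‖e‖ ≤ 1) :
    ∫ x in A, fderiv ℝ S x e ≤ B := by
  obtain ⟨L, hL⟩ := hS.lipschitzWith_of_hasCompactSupport hSc (by simp)
  obtain ⟨ρ, hρ⟩ := hSc.isCompact.isBounded.exists_norm_le
  have hρ' : ∀ x, S x ≠ 0 → ‖x‖ ≤ ρ := fun x hx => hρ x (subset_tsupport S hx)
  -- The truncation makes the indicator integrable. The radius `ρ + 1` leaves room for translations
  -- of length at most 1, so it does not change the integrals against `S`.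
  set A' := A ∩ Metric.closedBall (0 : Space n) (ρ + 1) with hA'
  have hA'm : NullMeasurableSet A' volume :=
    hA.inter Metric.isClosed_closedBall.measurableSet.nullMeasurableSet
  set g : Space n → ℝ := A'.indicator 1 with hg
  have hgi : Integrable g := by
    refine IntegrableOn.integrable_indicator₀ ?_ hA'm
    refine integrableOn_const (C := (1 : ℝ)) ?_
    exact ((measure_mono inter_subset_right).trans_lt
      (isCompact_closedBall _ _).measure_lt_top).ne
  have hlim := hL.integral_inv_smul_sub_mul_tendsto_integral_lineDeriv_mul hgi e
  have hSi : Integrable S := hS.continuous.integrable_of_hasCompactSupport hSc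
  have hd0 : ∀ x, ρ < ‖x‖ → fderiv ℝ S x = 0 := by
    intro x hx
    by_contra hne
    have : x ∈ tsupport (fderiv ℝ S) := subset_tsupport _ hne
    exact absurd (hρ x (tsupport_fderiv_subset ℝ this)) (not_le.2 hx)
  have heq : ∫ x in A, fderiv ℝ S x e = ∫ x, lineDeriv ℝ S x e * g x := by
    rw [← integral_indicator₀ hA]
    refine integral_congr_ae (Eventually.of_forall fun x => ?_)
    beta_reduce
    rw [(hS.differentiable (by simp) x).lineDeriv_eq_fderiv]
    by_cases hx : ‖x‖ ≤ ρ
    · by_cases hxA : x ∈ A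
      · have : x ∈ A' := ⟨hxA, by simpa using hx.trans (by linarith)⟩
        simp [hg, hxA, this]
      · have : x ∉ A' := fun h => hxA h.1
        simp [hg, hxA, this]
    · simp [indicator, hd0 x (not_le.1 hx)]
  rw [heq]
  refine le_of_tendsto hlim ?_
  have hr1 : (0 : ℝ) < min r 1 := lt_min hr one_pos
  filter_upwards [Ioc_mem_nhdsGT hr1] with t ht
  have ht0 : 0 < t := ht.1
  set f : Space n → ℝ := A.indicator 1 with hf
  have hfb : ∀ x, f x = 0 ∨ f x = 1 := fun x => by
    by_cases hx : x ∈ A <;> simp [hf, hx]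
  have hmul : ∀ (S : Space n → ℝ) x, S x * f x = A.indicator S x := fun S x => by
    by_cases hx : x ∈ A <;> simp [hf, hx]
  have hte : ‖t • e‖ ≤ t := by
    rw [norm_smul, Real.norm_of_nonneg ht0.le]
    exact mul_le_of_le_one_right ht0.le he
  have hSti : Integrable fun x => S (x + t • e) := hSi.comp_add_right _
  have hi1 : Integrable fun x => S (x + t • e) * f x := by
    simp only [hmul fun x => S (x + t • e)]
    exact hSti.integrableOn.integrable_indicator₀ hA
  have hi2 : Integrable fun x => S x * f x := by
    simp only [hmul]
    exact hSi.integrableOn.integrable_indicator₀ hA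
  have hi3 : Integrable fun x => S x * f (x - t • e) := by
    simpa using hi1.comp_sub_right (t • e)
  have e1 : ∫ x, (t⁻¹ • (S (x + t • e) - S x)) * g x
      = t⁻¹ * ∫ x, (S (x + t • e) * f x - S x * f x) := by
    rw [← integral_const_mul]
    congr 1
    funext x
    by_cases hx : ‖x‖ ≤ ρ + 1
    · have : g x = f x := by
        by_cases hxA : x ∈ A
        · have : x ∈ A' := ⟨hxA, by simpa using hx⟩
          simp [hg, hf, hxA, this]
        · have : x ∉ A' := fun h => hxA h.1
          simp [hg, hf, hxA, this]
      rw [this, smul_eq_mul]; ring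
    · have h1 : S x = 0 := by
        by_contra hne
        have := hρ' x hne
        linarith
      have h2 : S (x + t • e) = 0 := by
        by_contra hne
        have h3 := hρ' _ hne
        have h4 : ‖x‖ ≤ ‖x + t • e‖ + ‖t • e‖ := by
          simpa using norm_sub_le (x + t • e) (t • e)
        have h5 := ht.2.trans (min_le_right _ _)
        linarith
      simp [h1, h2]
  have e2 : ∫ x, (S (x + t • e) * f x - S x * f x)
      = ∫ x, S x * (f (x - t • e) - f x) := by
    rw [integral_sub hi1 hi2, ← integral_sub_right_eq_self (fun x => S (x + t • e) * f x) (t • e)]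
    simp only [sub_add_cancel]
    rw [← integral_sub hi3 hi2]
    simp only [mul_sub]
  rw [e1, e2, inv_mul_le_iff₀ ht0]
  refine (le_abs_self _).trans ?_
  rw [← ENNReal.ofReal_le_ofReal_iff (by positivity), ← Real.enorm_eq_ofReal_abs]
  refine (enorm_integral_le_lintegral_enorm _).trans ?_
  set D := {x | x ∈ G ∧ ¬ (x ∈ A ↔ x + -(t • e) ∈ A)} with hD
  calc ∫⁻ x, ‖S x * (f (x - t • e) - f x)‖ₑ
      ≤ ∫⁻ x, D.indicator 1 x := by
        refine lintegral_mono fun x => ?_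
        by_cases hx : x ∈ D
        · rw [indicator_of_mem hx, Pi.one_apply, Real.enorm_eq_ofReal_abs,
            ← ENNReal.ofReal_one, abs_mul]
          apply ENNReal.ofReal_le_ofReal
          refine mul_le_one₀ (hS1 x) (abs_nonneg _) ?_
          rcases hfb x with h | h <;> rcases hfb (x - t • e) with h' | h' <;> simp [h, h']
        · rw [indicator_of_notMem hx, nonpos_iff_eq_zero, enorm_eq_zero]
          by_cases hSx : S x = 0
          · simp [hSx]
          · have : x ∈ A ↔ x - t • e ∈ A := by
              by_contra hne
              exact hx ⟨hSG x hSx, by rwa [← sub_eq_add_neg]⟩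
            by_cases hxA : x ∈ A
            · simp [hf, hxA, this.1 hxA]
            · have h2 : x - t • e ∉ A := fun h => hxA (this.2 h)
              simp [hf, hxA, h2]
    _ ≤ volume D := lintegral_indicator_one_le D
    _ ≤ ENNReal.ofReal (B * ‖-(t • e)‖) := hB _ (by
        rw [norm_neg]; exact hte.trans (ht.2.trans (min_le_left _ _)))
    _ ≤ ENNReal.ofReal (t * B) := by
        apply ENNReal.ofReal_le_ofReal
        rw [norm_neg, mul_comm]
        gcongr

/-! ### The divergence of compactly supported fields, cutoffs, and the perimeter bound. -/

theorem continuous_divergence {n : ℕ} {T : Space n → Space n} (hT : ContDiff ℝ 1 T) :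
    Continuous (divergence T) := by
  unfold divergence
  refine continuous_finsetSum _ fun a _ => ?_
  have h1 : Continuous fun x => fderiv ℝ T x (EuclideanSpace.single a 1) :=
    (hT.continuous_fderiv (by simp)).clm_apply continuous_const
  fun_prop

theorem hasCompactSupport_divergence {n : ℕ} {T : Space n → Space n} (hT : HasCompactSupport T) :
    HasCompactSupport (divergence T) := by
  refine (hT.fderiv ℝ).mono fun x hx => ?_
  intro h0
  apply hx
  simp only [divergence]
  have : fderiv ℝ T x = 0 := h0
  simp [this]

theorem divergence_add {n : ℕ} {T T' : Space n → Space n} (hT : ContDiff ℝ 1 T)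
    (hT' : ContDiff ℝ 1 T') (x : Space n) :
    divergence (fun x => T x + T' x) x = divergence T x + divergence T' x := by
  simp only [divergence]
  rw [← Finset.sum_add_distrib]
  refine Finset.sum_congr rfl fun a _ => ?_
  rw [fderiv_fun_add (hT.differentiable (by simp) x) (hT'.differentiable (by simp) x)]
  simp

theorem fderiv_coord {n : ℕ} {T : Space n → Space n} (hT : ContDiff ℝ 1 T) (x e : Space n)
    (a : Fin n) : (fderiv ℝ T x e) a = fderiv ℝ (fun x => T x a) x e := by
  have h1 := (hT.differentiable (by simp) x).hasFDerivAt
  have h2 : HasFDerivAt (fun x => T x a) ((EuclideanSpace.proj a).comp (fderiv ℝ T x)) x :=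
    (EuclideanSpace.proj a : Space n →L[ℝ] ℝ).hasFDerivAt.comp x h1
  rw [h2.fderiv]
  rfl

theorem setIntegral_divergence_le_of_translates {n : ℕ} {A G : Set (Space n)}
    (hA : NullMeasurableSet A volume) {B r : ℝ} (hB0 : 0 ≤ B) (hr : 0 < r)
    (hB : ∀ τ : Space n, ‖τ‖ ≤ r →
      volume {x | x ∈ G ∧ ¬ (x ∈ A ↔ x + τ ∈ A)} ≤ ENNReal.ofReal (B * ‖τ‖))
    {T : Space n → Space n} (hT : ContDiff ℝ 1 T) (hTc : HasCompactSupport T)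
    (hT1 : ∀ x, ‖T x‖ ≤ 1) (hTG : ∀ x, T x ≠ 0 → x ∈ G) :
    ∫ x in A, divergence T x ≤ n * B := by
  have hTa : ∀ a, ContDiff ℝ 1 fun x => T x a := fun a =>
    (EuclideanSpace.proj a : Space n →L[ℝ] ℝ).contDiff.comp hT
  have hTac : ∀ a, HasCompactSupport fun x => T x a := fun a =>
    hTc.comp_left (g := fun y : Space n => y a) rfl
  simp only [divergence, fderiv_coord hT]
  rw [integral_finsetSum]
  · calc ∑ a : Fin n, ∫ x in A, fderiv ℝ (fun x => T x a) x (EuclideanSpace.single a 1)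
        ≤ ∑ _a : Fin n, B := by
          refine Finset.sum_le_sum fun a _ => ?_
          refine setIntegral_lineDeriv_le_of_translates hA hB0 hr hB (hTa a) (hTac a)
            (fun x => (abs_coord_le_norm _ a).trans (hT1 x)) (fun x hx => hTG x ?_) (by simp)
          intro h0
          exact hx (by simp [h0])
      _ = n * B := by simp
  · intro a _
    refine Integrable.integrableOn (Continuous.integrable_of_hasCompactSupport ?_ ?_)
    · exact ((hTa a).continuous_fderiv (by simp)).clm_apply continuous_const
    · exact ((hTac a).fderiv ℝ).mono fun x hx h0 => hx (by
        have : fderiv ℝ (fun x => T x a) x = 0 := h0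
        simp [this])

theorem exists_contDiff_zero_one {F : Type*} [NormedAddCommGroup F] [NormedSpace ℝ F]
    [FiniteDimensional ℝ F] {s t : Set F} (hs : IsClosed s) (ht : IsClosed t)
    (hd : Disjoint s t) :
    ∃ ψ : F → ℝ, ContDiff ℝ 1 ψ ∧ EqOn ψ 0 s ∧ EqOn ψ 1 t ∧ ∀ x, ψ x ∈ Icc (0 : ℝ) 1 := by
  obtain ⟨f, h0, h1, h01⟩ := exists_contMDiffMap_zero_one_of_isClosed (n := 1)
    (modelWithCornersSelf ℝ F) hs ht hd
  exact ⟨f, contMDiff_iff_contDiff.1 f.contMDiff, h0, h1, h01⟩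

theorem exists_cutoff {n : ℕ} (Ω : Set (Space n)) {δ : ℝ} (hδ : 0 < δ) :
    ∃ ψ : Space n → ℝ, ContDiff ℝ 1 ψ ∧ (∀ x, 0 ≤ ψ x ∧ ψ x ≤ 1) ∧
      (∀ x ∈ innerSet Ω δ, ψ x = 1) ∧ ∀ x, ψ x ≠ 0 → x ∈ innerSet Ω (δ / 2) := by
  have hc : Continuous fun x : Space n => Metric.infDist x Ωᶜ := Metric.continuous_infDist_pt _
  have hdisj : Disjoint {x : Space n | Metric.infDist x Ωᶜ ≤ δ / 2}
      {x | δ ≤ Metric.infDist x Ωᶜ} := by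
    rw [Set.disjoint_left]
    intro x hx hx'
    simp only [mem_ofPred_eq] at hx hx'
    linarith
  obtain ⟨f, hf, h0, h1, h01⟩ := exists_contDiff_zero_one (isClosed_le hc continuous_const)
    (isClosed_le continuous_const hc) hdisj
  refine ⟨f, hf, fun x => mem_Icc.1 (h01 x), fun x hx => ?_, fun x hx => ?_⟩
  · have hxt : x ∈ {x | δ ≤ Metric.infDist x Ωᶜ} := by
      rw [mem_ofPred_eq]; exact hx.2.le
    simpa using h1 hxt
  · rw [mem_innerSet_iff (by positivity)]
    by_contra hle
    have hxs : x ∈ {x | Metric.infDist x Ωᶜ ≤ δ / 2} := by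
      rw [mem_ofPred_eq]; exact not_lt.1 hle
    exact hx (by simpa using h0 hxs)

/-- Split `T = ψ T + (1 - ψ) T` with `ψ = 1` on `Ω_δ` and `ψ = 0` off `Ω_{δ/2}`. The first field is
handled by the translates of `A`. The divergence of the second vanishes on `Ω_δ`, and elsewhere `A`
agrees with `A₀`, so the perimeter bound of `A₀` applies. -/
theorem hasFinitePerimeter_of_translates {n : ℕ} {A A₀ Ω : Set (Space n)}
    (hA₀ : HasFinitePerimeter A₀) (hA : NullMeasurableSet A volume) {δ : ℝ} (hδ : 0 < δ)
    (hAA₀ : volume (symmDiff A A₀ ∩ (innerSet Ω δ)ᶜ) = 0) {B r : ℝ} (hB0 : 0 ≤ B) (hr : 0 < r)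
    (hB : ∀ τ : Space n, ‖τ‖ ≤ r →
      volume {x | x ∈ innerSet Ω (δ / 2) ∧ ¬ (x ∈ A ↔ x + τ ∈ A)} ≤ ENNReal.ofReal (B * ‖τ‖)) :
    HasFinitePerimeter A := by
  obtain ⟨hA₀m, C, hC⟩ := hA₀
  refine ⟨hA, n * B + C, fun T hT hTc hT1 => ?_⟩
  obtain ⟨ψ, hψ, hψ01, hψ1, hψ0⟩ := exists_cutoff Ω hδ
  have hU : ContDiff ℝ 1 fun x => ψ x • T x := hψ.smul hT
  have hV : ContDiff ℝ 1 fun x => (1 - ψ x) • T x := (contDiff_const.sub hψ).smul hT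
  have hUc : HasCompactSupport fun x => ψ x • T x :=
    hTc.mono fun x hx h0 => hx (by simp [show T x = 0 from h0])
  have hVc : HasCompactSupport fun x => (1 - ψ x) • T x := 
    hTc.mono fun x hx h0 => hx (by simp [show T x = 0 from h0])
  have hsum : ∀ x, divergence T x
      = divergence (fun x => ψ x • T x) x + divergence (fun x => (1 - ψ x) • T x) x := by
    intro x
    rw [← divergence_add hU hV]
    congr 1
    funext x
    rw [← add_smul]; simp
  have hUi := (continuous_divergence hU).integrable_of_hasCompactSupport (μ := volume)
    (hasCompactSupport_divergence hUc)
  have hVi := (continuous_divergence hV).integrable_of_hasCompactSupport (μ := volume)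
    (hasCompactSupport_divergence hVc)
  simp only [hsum]
  rw [integral_add hUi.integrableOn hVi.integrableOn]
  refine add_le_add ?_ ?_
  · refine setIntegral_divergence_le_of_translates hA hB0 hr hB hU hUc (fun x => ?_) fun x hx => ?_
    · rw [norm_smul, Real.norm_of_nonneg (hψ01 x).1]
      exact mul_le_one₀ (hψ01 x).2 (norm_nonneg _) (hT1 x)
    · exact hψ0 x fun h0 => hx (by simp [h0])
  · have heq : ∫ x in A, divergence (fun x => (1 - ψ x) • T x) x
        = ∫ x in A₀, divergence (fun x => (1 - ψ x) • T x) x := by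
      rw [← integral_indicator₀ hA, ← integral_indicator₀ hA₀m]
      refine integral_congr_ae ?_
      have hae : ∀ᵐ x ∂(volume : Measure (Space n)), x ∉ symmDiff A A₀ ∩ (innerSet Ω δ)ᶜ :=
        measure_eq_zero_iff_ae_notMem.1 hAA₀
      filter_upwards [hae] with x hx
      by_cases hxΩ : x ∈ innerSet Ω δ
      · have hz : divergence (fun x => (1 - ψ x) • T x) x = 0 := by
          have h1 : (fun x => (1 - ψ x) • T x) =ᶠ[𝓝 x] fun _ => 0 := by
            filter_upwards [(isOpen_innerSet hδ.le).mem_nhds hxΩ] with y hy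
            simp [hψ1 y hy]
          simp [divergence, h1.fderiv_eq]
        simp [indicator, hz]
      · have hiff : x ∈ A ↔ x ∈ A₀ := by
          rw [mem_inter_iff, mem_symmDiff] at hx
          have : x ∈ (innerSet Ω δ)ᶜ := hxΩ
          tauto
        by_cases hxA : x ∈ A
        · rw [indicator_of_mem hxA, indicator_of_mem (hiff.1 hxA)]
        · rw [indicator_of_notMem hxA, indicator_of_notMem fun h => hxA (hiff.2 h)]
    rw [heq]
    refine hC _ hV hVc fun x => ?_
    rw [norm_smul, Real.norm_of_nonneg (by linarith [(hψ01 x).2])]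
    exact mul_le_one₀ (by linarith [(hψ01 x).1]) (norm_nonneg _) (hT1 x)

/-! ### Compactness and lower semicontinuity -/

theorem exists_subset_cube {n : ℕ} {G : Set (Space n)} (hG : Bornology.IsBounded G) :
    ∃ R : ℝ, 0 < R ∧ G ⊆ {x : Space n | ∀ a, |x a| < R / 2} := by
  obtain ⟨r, hr0, hr⟩ := hG.exists_pos_norm_lt
  refine ⟨2 * r, by positivity, fun x hx a => ?_⟩
  have := (abs_coord_le_norm x a).trans_lt (hr x hx)
  linarith

theorem measure_eq_zero_of_cubes {n : ℕ} {s : Set (Space n)}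
    (h : ∀ R : ℝ, 0 < R → volume (s ∩ {x : Space n | ∀ a, |x a| < R / 2}) = 0) :
    volume s = 0 := by
  have : s ⊆ ⋃ N : ℕ, s ∩ {x : Space n | ∀ a, |x a| < ((N : ℝ) + 1) / 2} := by
    intro x hx
    obtain ⟨N, hN⟩ := exists_nat_gt (2 * ‖x‖)
    refine mem_iUnion.2 ⟨N, hx, fun a => ?_⟩
    have := abs_coord_le_norm x a
    linarith
  refine measure_mono_null this (measure_iUnion_null fun N => h _ (by positivity))

theorem ConvergesTo.tendsto_volume_inter {n K h : ℕ} {X : Type*} {v : Fin K → Config n X}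
    {ε : ℕ → ℝ} {u : ℕ → Config n X} {A : Fin K → Set (Space n)} (H : ConvergesTo h v ε u A)
    {G : Set (Space n)} (hG : Bornology.IsBounded G) (l : Fin K) :
    Tendsto (fun k => volume (symmDiff (phase h (v l) (ε k) (u k)) (A l) ∩ G)) atTop (𝓝 0) := by
  obtain ⟨R, hR, hsub⟩ := exists_subset_cube hG
  exact tendsto_of_tendsto_of_tendsto_of_le_of_le tendsto_const_nhds (H l R hR)
    (fun _ => zero_le) fun k => measure_mono (inter_subset_inter_right _ hsub)

theorem ConvergesTo.volume_inter_eq_zero {n K h : ℕ} (hh : 1 ≤ h) {X : Type*}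
    {v : Fin K → Config n X} (hv_inj : Function.Injective v) (hv_per : ∀ l, IsPeriodic h (v l))
    {ε : ℕ → ℝ} (hε : ∀ k, 0 < ε k) {u : ℕ → Config n X} {A : Fin K → Set (Space n)}
    (H : ConvergesTo h v ε u A) {l l' : Fin K} (hl : l ≠ l') : volume (A l ∩ A l') = 0 := by
  refine measure_eq_zero_of_cubes fun R hR => ?_
  set Q := {x : Space n | ∀ a, |x a| < R / 2}
  have hlim := (H l R hR).add (H l' R hR)
  rw [add_zero] at hlim
  refine le_antisymm (ge_of_tendsto' hlim fun k => ?_) zero_le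
  refine (measure_mono ?_).trans (measure_union_le _ _)
  rintro x ⟨⟨hx, hx'⟩, hQ⟩
  by_cases hp : x ∈ phase h (v l) (ε k) (u k)
  · have hp' := Set.disjoint_left.1 (disjoint_phase hh hv_inj hv_per (hε k) (u k) hl) hp
    exact Or.inr ⟨mem_symmDiff.2 (Or.inr ⟨hx', hp'⟩), hQ⟩
  · exact Or.inl ⟨mem_symmDiff.2 (Or.inr ⟨hx, hp⟩), hQ⟩

theorem symmDiff_glue_inter_compl {α : Type*} (A' A₀ D : Set α) :
    symmDiff (A' ∩ D ∪ A₀ \ D) A₀ ∩ Dᶜ = ∅ := by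
  ext x
  simp only [mem_inter_iff, mem_symmDiff, mem_union, Set.mem_sdiff, mem_compl_iff,
    mem_empty_iff_false]
  tauto

theorem symmDiff_glue_inter_subset {α : Type*} {D G : Set α} (h : D ⊆ G) (E A' A₀ Q : Set α) :
    symmDiff E (A' ∩ D ∪ A₀ \ D) ∩ Q ⊆ (symmDiff E A' ∩ G) ∪ (symmDiff E A₀ ∩ Q ∩ Dᶜ) := by
  rintro x ⟨hx, hxR⟩
  have hxG := @h x
  simp only [mem_inter_iff, mem_symmDiff, mem_union, Set.mem_sdiff, mem_compl_iff] at hx ⊢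
  tauto

theorem not_mem_iff_add_subset {n : ℕ} {A E G G' : Set (Space n)} {τ : Space n} (hG : G' ⊆ G)
    (hτ : ∀ x ∈ G', x + τ ∈ G) :
    {x | x ∈ G' ∧ ¬ (x ∈ A ↔ x + τ ∈ A)} ⊆ {x | x ∈ G ∧ ¬ (x ∈ E ↔ x + τ ∈ E)} ∪
      (symmDiff E A ∩ G) ∪ (fun x => x + τ) ⁻¹' (symmDiff E A ∩ G) := by
  rintro x ⟨hx, hne⟩
  have hxG := hG hx
  have hxG' := hτ x hx
  simp only [mem_union, mem_ofPred_eq, mem_inter_iff, mem_symmDiff, mem_preimage, hxG, hxG']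
  tauto

/-- The translate estimates hold inside `Ω`, while outside `Ω_δ` the limit is prescribed; so `A` is
glued from the compactness limit in `Ω_δ` and `A₀` outside. As `ε → 0` the error `3 ε` disappears,
which leaves a bound linear in `‖τ‖` and hence finite perimeter. The uncovered volume, at most `C ε
b` in `G`, vanishes too, so the limit sets cover. -/
theorem exists_subseq_convergesTo {n K h : ℕ} (hn : 1 ≤ n) (hh : 1 ≤ h) {X : Type*}
    {φ : Config n X → ℝ} (hφ : ∀ u, 0 ≤ φ u) {v : Fin K → Config n X}
    (hv_inj : Function.Injective v) (hv_per : ∀ l, IsPeriodic h (v l))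
    (H1 : GroundStates φ v) (H2 : Coercive φ h v) (H3 : MildlyNonlocal φ)
    {Ω : Set (Space n)} (hΩ : Bornology.IsBounded Ω)
    {A₀ : Fin K → Set (Space n)} (hA₀ : IsFinitePerimeterPartition A₀)
    {ε : ℕ → ℝ} (hε_pos : ∀ k, 0 < ε k) (hε_lim : Tendsto ε atTop (𝓝 0))
    {u : ℕ → Config n X} {δ : ℝ} (hδ : 0 < δ) {b : ℝ≥0∞} (hb : b ≠ ⊤)
    (hE : ∀ j, energy φ (ε j) (u j) Ω ≤ b)
    (hoff : ∀ (l : Fin K) (R : ℝ), 0 < R → Tendsto (fun j =>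
      volume (symmDiff (phase h (v l) (ε j) (u j)) (A₀ l) ∩ {x : Space n | ∀ a, |x a| < R / 2}
        ∩ (innerSet Ω δ)ᶜ)) atTop (𝓝 0)) :
    ∃ θ : ℕ → ℕ, StrictMono θ ∧ ∃ A ∈ continuumAdmissible Ω δ A₀,
      ConvergesTo h v (ε ∘ θ) (u ∘ θ) A := by
  obtain ⟨R, C, hC, hvol⟩ := exists_volume_le_energy hn hh hφ hv_inj hv_per H1 H2 H3
  -- Then `G` is `Ω_{δ/4}`, and points of `Ω_{δ/2}` moved by at most `η / 2` stay in `G`.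
  set η := δ / 8 with hη
  have hη0 : 0 < η := by positivity
  set G := innerSet Ω (2 * η) with hG
  have hGm : MeasurableSet G := (isOpen_innerSet (by positivity)).measurableSet
  have hGb : Bornology.IsBounded G := hΩ.subset innerSet_subset
  have hδG : innerSet Ω δ ⊆ G := innerSet_anti (by linarith)
  have hsmall : ∀ᶠ j in atTop, n * (ε j * R) ≤ η ∧ n * ε j ≤ η / 2 := by
    have h1 : Tendsto (fun j => n * (ε j * R)) atTop (𝓝 (n * (0 * R))) :=
      (hε_lim.mul_const _).const_mul _
    have h2 : Tendsto (fun j => n * ε j) atTop (𝓝 (n * 0)) := hε_lim.const_mul _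
    rw [zero_mul, mul_zero] at h1
    rw [mul_zero] at h2
    exact (h1.eventually_le_const hη0).and (h2.eventually_le_const (by positivity))
  have hCb : C * b ≠ ⊤ := ENNReal.mul_ne_top hC hb
  have h3ε : Tendsto (fun j => 3 * ε j) atTop (𝓝 0) := by simpa using hε_lim.const_mul 3
  have htrans : ∀ᶠ j in atTop, ∀ τ : Space n, ‖τ‖ ≤ η / 2 → ∀ l,
      volume {x | x ∈ G ∧ ¬ (x ∈ phase h (v l) (ε j) (u j) ↔ x + τ ∈ phase h (v l) (ε j) (u j))}
        ≤ C * b * ENNReal.ofReal (‖τ‖ + 3 * ε j) := by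
    filter_upwards [hsmall] with j hj τ hτ l
    refine (measure_mono ?_).trans
      (((hvol Ω (ε j) η (hε_pos j) hη0 hj.1 hj.2 (u j)).2 τ hτ).trans ?_)
    · exact fun x hx => ⟨hx.1, l, hx.2⟩
    · rw [mul_right_comm]
      gcongr
      exact hE j
  obtain ⟨θ, hθ, A', hA'm, hA'⟩ := exists_subseq_tendsto_of_translates hGm hGb
    (E := fun j l => phase h (v l) (ε j) (u j))
    (fun j l => measurableSet_phase hh (hε_pos j) _ _) hCb (half_pos hη0) h3ε htrans
  set A : Fin K → Set (Space n) := fun l => (A' l ∩ innerSet Ω δ) ∪ (A₀ l \ innerSet Ω δ) with hA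
  have hδm : MeasurableSet (innerSet Ω δ) := (isOpen_innerSet hδ.le).measurableSet
  have hAm : ∀ l, NullMeasurableSet (A l) volume := fun l =>
    ((hA'm l).nullMeasurableSet.inter hδm.nullMeasurableSet).union
      ((hA₀.1 l).1.diff hδm.nullMeasurableSet)
  have hAA₀ : ∀ l, volume (symmDiff (A l) (A₀ l) ∩ (innerSet Ω δ)ᶜ) = 0 := by
    intro l
    rw [hA, symmDiff_glue_inter_compl, measure_empty]
  have hconv : ConvergesTo h v (ε ∘ θ) (u ∘ θ) A := by
    intro l R hR
    have h1 := (hA' l).add ((hoff l R hR).comp hθ.tendsto_atTop)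
    rw [add_zero] at h1
    refine tendsto_of_tendsto_of_tendsto_of_le_of_le tendsto_const_nhds h1
      (fun _ => zero_le) fun k => ?_
    exact (measure_mono (symmDiff_glue_inter_subset hδG _ _ _ _)).trans (measure_union_le _ _)
  have hθε : Tendsto (ε ∘ θ) atTop (𝓝 0) := hε_lim.comp hθ.tendsto_atTop
  have hper : ∀ l, HasFinitePerimeter (A l) := by
    intro l
    refine hasFinitePerimeter_of_translates (hA₀.1 l) (hAm l) hδ (hAA₀ l)
      (B := (C * b).toReal) (r := η / 2) ENNReal.toReal_nonneg (half_pos hη0) fun τ hτ => ?_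
    rw [ENNReal.ofReal_mul ENNReal.toReal_nonneg, ENNReal.ofReal_toReal hCb]
    have hG0 := hconv.tendsto_volume_inter hGb l
    have h1 : Tendsto (fun j => C * b * ENNReal.ofReal (‖τ‖ + 3 * (ε ∘ θ) j)) atTop
        (𝓝 (C * b * ENNReal.ofReal (‖τ‖ + 3 * 0))) :=
      ENNReal.Tendsto.const_mul ((ENNReal.continuous_ofReal.tendsto _).comp
        ((hθε.const_mul 3).const_add _)) (Or.inr hCb)
    have h2 := (h1.add hG0).add hG0
    rw [mul_zero, add_zero, add_zero, add_zero] at h2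
    refine ge_of_tendsto h2 ?_
    filter_upwards [hθ.tendsto_atTop.eventually htrans] with j hj
    set E := phase h (v l) ((ε ∘ θ) j) ((u ∘ θ) j) with hEdef
    have hsub : {x | x ∈ innerSet Ω (δ / 2) ∧ ¬ (x ∈ A l ↔ x + τ ∈ A l)}
        ⊆ {x | x ∈ G ∧ ¬ (x ∈ E ↔ x + τ ∈ E)} ∪ (symmDiff E (A l) ∩ G) ∪
          (fun x => x + τ) ⁻¹' (symmDiff E (A l) ∩ G) :=
      not_mem_iff_add_subset (innerSet_anti (by linarith)) fun x hx =>
        mem_innerSet_of_dist_le (by positivity) (r := η / 2) (by linarith) hx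
          (by rwa [dist_self_add_right])
    refine (measure_mono hsub).trans ((measure_union_le _ _).trans
      (add_le_add ((measure_union_le _ _).trans (add_le_add (hj τ hτ l) le_rfl)) ?_))
    rw [measure_preimage_add_right]
  refine ⟨θ, hθ, A, ⟨⟨hper, fun l l' hl => ?_, ?_⟩, hAA₀⟩, hconv⟩
  · exact hconv.volume_inter_eq_zero hh hv_inj hv_per (fun k => hε_pos (θ k)) hl
  · have h0 : volume ((⋃ l, A l)ᶜ ∩ G) = 0 := by
      have h1 : Tendsto (fun j => C * ENNReal.ofReal ((ε ∘ θ) j) * b +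
          ∑ l, volume (symmDiff (phase h (v l) ((ε ∘ θ) j) ((u ∘ θ) j)) (A l) ∩ G)) atTop
          (𝓝 (C * ENNReal.ofReal 0 * b + ∑ _l : Fin K, 0)) := by
        refine Tendsto.add ?_ (tendsto_finsetSum _ fun l _ => hconv.tendsto_volume_inter hGb l)
        exact ENNReal.Tendsto.mul_const (ENNReal.Tendsto.const_mul
          ((ENNReal.continuous_ofReal.tendsto _).comp hθε) (Or.inr hC)) (Or.inr hb)
      simp only [ENNReal.ofReal_zero, mul_zero, zero_mul, Finset.sum_const_zero, add_zero] at h1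
      refine le_antisymm (ge_of_tendsto h1 ?_) zero_le
      filter_upwards [hθ.tendsto_atTop.eventually hsmall] with j hj
      have h2 := (hvol Ω (ε (θ j)) η (hε_pos _) hη0 hj.1 hj.2 (u (θ j))).1
      have hsub : (⋃ l, A l)ᶜ ∩ G ⊆ {x | x ∈ G ∧ ∀ l, x ∉ phase h (v l) (ε (θ j)) (u (θ j))} ∪
          ⋃ l, (symmDiff (phase h (v l) ((ε ∘ θ) j) ((u ∘ θ) j)) (A l) ∩ G) := by
        rintro x ⟨hx, hxG⟩
        by_cases hex : ∀ l, x ∉ phase h (v l) (ε (θ j)) (u (θ j))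
        · exact Or.inl ⟨hxG, hex⟩
        · push Not at hex
          obtain ⟨l, hl⟩ := hex
          refine Or.inr (mem_iUnion.2 ⟨l, mem_symmDiff.2 (Or.inl ⟨hl, fun h' => ?_⟩), hxG⟩)
          exact hx (mem_iUnion.2 ⟨l, h'⟩)
      refine (measure_mono hsub).trans ((measure_union_le _ _).trans (add_le_add (h2.trans ?_) ?_))
      · gcongr
        · exact le_rfl
        · exact hE _
      · exact measure_iUnion_fintype_le _ _
    refine measure_mono_null (t := ((⋃ l, A l)ᶜ ∩ G) ∪ (⋃ l, A₀ l)ᶜ) ?_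
      (measure_union_null h0 hA₀.2.2)
    intro x hx
    by_cases hxδ : x ∈ innerSet Ω δ
    · exact Or.inl ⟨hx, hδG hxδ⟩
    · refine Or.inr fun h' => hx ?_
      obtain ⟨l, hl⟩ := mem_iUnion.1 h'
      exact mem_iUnion.2 ⟨l, Or.inr ⟨hl, hxδ⟩⟩

/-- The liminf inequality concerns full sequences. The indices missed by the subsequence are filled
with a recovery sequence of the limit, which preserves convergence, and the liminf of a sequence is
at most that of any subsequence. -/
theorem exists_continuumAdmissible_le {n K h : ℕ} (hn : 1 ≤ n) (hh : 1 ≤ h) {X : Type*}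
    {φ : Config n X → ℝ} (hφ : ∀ u, 0 ≤ φ u) {v : Fin K → Config n X}
    (hv_inj : Function.Injective v) (hv_per : ∀ l, IsPeriodic h (v l))
    (H1 : GroundStates φ v) (H2 : Coercive φ h v) (H3 : MildlyNonlocal φ)
    {Ω : Set (Space n)} (hΩ : Bornology.IsBounded Ω)
    {A₀ : Fin K → Set (Space n)} (hA₀ : IsFinitePerimeterPartition A₀)
    {ε : ℕ → ℝ} (hε_pos : ∀ k, 0 < ε k) (hε_lim : Tendsto ε atTop (𝓝 0))
    {F₀ : (Fin K → Set (Space n)) → ℝ≥0∞} (hF₀ : IsGammaLimit φ h v ε Ω F₀)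
    {κ : ℕ → ℕ} (hκ : StrictMono κ) {u : ℕ → Config n X} {δ : ℝ} (hδ : 0 < δ)
    {b : ℕ → ℝ≥0∞} {a : ℝ≥0∞} (ha : a ≠ ⊤) (hb : Tendsto b atTop (𝓝 a))
    (hE : ∀ j, energy φ (ε (κ j)) (u j) Ω ≤ b j)
    (hoff : ∀ (l : Fin K) (R : ℝ), 0 < R → Tendsto (fun j =>
      volume (symmDiff (phase h (v l) (ε (κ j)) (u j)) (A₀ l) ∩
        {x : Space n | ∀ a, |x a| < R / 2} ∩ (innerSet Ω δ)ᶜ)) atTop (𝓝 0)) :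
    ∃ A ∈ continuumAdmissible Ω δ A₀, F₀ A ≤ a := by
  -- Dropping finitely many terms gives the uniform bound `a + 1` on the energies.
  obtain ⟨J, hJ⟩ := eventually_atTop.1
    (hb.eventually_le_const (ENNReal.lt_add_right ha one_ne_zero))
  have hJs : StrictMono fun j : ℕ => j + J := fun i j hij => by simpa using hij
  obtain ⟨θ, hθ, A, hA, hconv⟩ := exists_subseq_convergesTo hn hh hφ hv_inj hv_per H1 H2 H3 hΩ hA₀
    (ε := fun j => ε (κ (j + J))) (fun _ => hε_pos _)
    (hε_lim.comp (hκ.comp hJs).tendsto_atTop) (u := fun j => u (j + J)) hδ (b := a + 1)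
    (by simpa using ha) (fun j => (hE _).trans (hJ _ (by simp)))
    fun l R hR => (hoff l R hR).comp hJs.tendsto_atTop
  refine ⟨A, hA, ?_⟩
  obtain ⟨hinf, r, hr, -⟩ := hF₀ A hA.1
  set ι : ℕ → ℕ := fun j => θ j + J with hι
  have hιs : StrictMono ι := hJs.comp hθ
  have hσ : StrictMono fun j => κ (ι j) := hκ.comp hιs
  set w : ℕ → Config n X := Function.extend (fun j => κ (ι j)) (fun j => u (ι j)) r with hw
  have hwσ : ∀ j, w (κ (ι j)) = u (ι j) := fun j => hσ.injective.extend_apply _ _ j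
  have hwc : ConvergesTo h v ε w A := by
    intro l R hR
    have h1 := hconv l R hR
    have h2 := hr l R hR
    rw [ENNReal.tendsto_nhds_zero] at h1 h2 ⊢
    intro e he
    obtain ⟨j₀, hj₀⟩ := eventually_atTop.1 (h1 e he)
    filter_upwards [h2 e he, eventually_ge_atTop (κ (ι j₀))] with k hk hk'
    by_cases hex : ∃ j, κ (ι j) = k
    · obtain ⟨j, rfl⟩ := hex
      rw [hwσ]
      exact hj₀ j (hσ.le_iff_le.1 hk')
    · rwa [hw, Function.extend_apply' _ _ _ hex]
  calc F₀ A ≤ liminf (fun k => energy φ (ε k) (w k) Ω) atTop := hinf w hwc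
    _ ≤ liminf (fun k => energy φ (ε k) (w k) Ω) (map (fun j => κ (ι j)) atTop) :=
        liminf_le_liminf_of_le hσ.tendsto_atTop
    _ = liminf (fun j => energy φ (ε (κ (ι j))) (u (ι j)) Ω) atTop := by
        rw [← Filter.liminf_comp]
        simp only [Function.comp_def, hwσ]
    _ ≤ liminf (fun j => b (ι j)) atTop := liminf_le_liminf (Eventually.of_forall fun j => hE _)
    _ = a := (hb.comp hιs.tendsto_atTop).liminf_eq

/-! ### Gluing along a well-chosen layer -/

theorem tsum_box_le {n : ℕ} {ε s : ℝ} (hε : 0 < ε) (hs : s ≤ ε) (S : Set (Fin n → ℤ))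
    {T : Set (Space n)}
    (hT : ∀ i ∈ S, ∀ x : Space n, (∀ a, ε * i a ≤ x a ∧ x a < ε * i a + s) → x ∈ T) :
    ∑' _ : S, ENNReal.ofReal s ^ n ≤ volume T := by
  have h1 : ∑' _ : S, ENNReal.ofReal s ^ n
      = volume (⋃ i : S, {x : Space n | ∀ a, ε * i.1 a ≤ x a ∧ x a < ε * i.1 a + s}) := by
    rw [measure_iUnion]
    · simp only [volume_box]
    · intro i j hij
      refine Set.disjoint_left.2 fun x hx hx' => hij (Subtype.ext ?_)
      have hx1 : site ε x = i.1 := (site_eq_iff hε x _).2 fun a =>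
        ⟨(hx a).1, (hx a).2.trans_le (by linarith)⟩
      have hx2 : site ε x = j.1 := (site_eq_iff hε x _).2 fun a =>
        ⟨(hx' a).1, (hx' a).2.trans_le (by linarith)⟩
      rw [← hx1, hx2]
    · exact fun i => measurableSet_box _ _
  rw [h1]
  refine measure_mono (iUnion_subset fun i x hx => hT i.1 i.2 x hx)

theorem dist_latticePoint_le_of_box {n : ℕ} {ε s : ℝ} (hs : s ≤ ε) {i : Fin n → ℤ} {x : Space n}
    (hx : ∀ a, ε * i a ≤ x a ∧ x a < ε * i a + s) : dist x (latticePoint ε i) ≤ n * ε := by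
  apply dist_le_mul_of_coord
  intro a
  have := hx a
  simp only [latticePoint]
  rw [abs_le]
  constructor <;> linarith

/-- In lattice units the faces of the cells have coordinates in ½ℤ, so a half-open box of side 1/2
based at a lattice point crosses none of them. This is why mismatches are measured with boxes of
side `ε / 2`. -/
theorem inCell_cellIndex_of_box {n h : ℕ} (hh : 1 ≤ h) {ε : ℝ} (hε : 0 < ε) {i : Fin n → ℤ}
    {x : Space n} (hx : ∀ a, ε * i a ≤ x a ∧ x a < ε * i a + ε / 2) :
    InCell h (cellIndex h ε x) (fun a => (i a : ℝ)) := by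
  intro a
  have h1 := inCell_cellIndex hh ε x a
  have h2 : (i a : ℝ) ≤ x a / ε := by rw [le_div_iff₀ hε]; linarith [(hx a).1]
  have h3 : x a / ε < i a + 1 / 2 := by rw [div_lt_iff₀ hε]; linarith [(hx a).2]
  refine ⟨?_, by linarith⟩
  have h4 : (2 * (h : ℤ) * cellIndex h ε x a - h - 1 : ℤ) < 2 * i a := by
    have : ((2 * (h : ℤ) * cellIndex h ε x a - h - 1 : ℤ) : ℝ) < ((2 * i a : ℤ) : ℝ) := by
      push_cast; linarith
    exact_mod_cast this
  have h5 : (2 * (h : ℤ) * cellIndex h ε x a - h : ℤ) ≤ 2 * i a := by omega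
  have h6 : ((2 * (h : ℤ) * cellIndex h ε x a - h : ℤ) : ℝ) ≤ ((2 * i a : ℤ) : ℝ) := by
    exact_mod_cast h5
  push_cast at h6
  linarith

/-- Two sequences which converge to partitions which agree near the boundary of `Ω` differ there
on few lattice sites. -/
theorem tendsto_tsum_mismatch {n K h : ℕ} (hh : 1 ≤ h) {X : Type*} {v : Fin K → Config n X}
    {Ω : Set (Space n)} (hΩ : Bornology.IsBounded Ω) {A A₀ : Fin K → Set (Space n)}
    (hA₀ : IsFinitePerimeterPartition A₀)
    {ε : ℕ → ℝ} (hε_pos : ∀ k, 0 < ε k) (hε_lim : Tendsto ε atTop (𝓝 0))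
    {u u₀ : ℕ → Config n X} (hu : ConvergesTo h v ε u A) (hu₀ : ConvergesTo h v ε u₀ A₀)
    {δ δ' : ℝ} (hδ' : 0 ≤ δ') (hδ : δ' < δ)
    (hA : ∀ l, volume (symmDiff (A l) (A₀ l) ∩ (innerSet Ω δ)ᶜ) = 0) :
    Tendsto (fun k => ∑' _ : {j | latticePoint (ε k) j ∈ Ω \ innerSet Ω δ' ∧ u k j ≠ u₀ k j},
      ENNReal.ofReal (ε k) ^ n) atTop (𝓝 0) := by
  set Q := Metric.thickening (n + 1) Ω with hQ
  have hQb : Bornology.IsBounded Q := hΩ.thickening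
  set Nu : Set (Space n) := (⋃ l, A₀ l)ᶜ ∪ ⋃ l, symmDiff (A l) (A₀ l) ∩ (innerSet Ω δ)ᶜ with hNu
  have hNu0 : volume Nu = 0 := measure_union_null hA₀.2.2 (measure_iUnion_null hA)
  have hlim : Tendsto (fun k => 2 ^ n *
      ∑ l, (volume (symmDiff (phase h (v l) (ε k) (u k)) (A l) ∩ Q) +
        volume (symmDiff (phase h (v l) (ε k) (u₀ k)) (A₀ l) ∩ Q))) atTop (𝓝 0) := by
    have h1 := ENNReal.Tendsto.const_mul (a := 2 ^ n) (tendsto_finsetSum Finset.univ fun l _ =>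
      (hu.tendsto_volume_inter hQb l).add (hu₀.tendsto_volume_inter hQb l))
      (Or.inr (ENNReal.pow_ne_top (by norm_num)))
    simpa using h1
  have hsmall : ∀ᶠ k in atTop, n * ε k ≤ δ - δ' ∧ ε k ≤ 1 := by
    have h2 : Tendsto (fun j => n * ε j) atTop (𝓝 (n * 0)) := hε_lim.const_mul _
    rw [mul_zero] at h2
    exact (h2.eventually_le_const (by linarith)).and (hε_lim.eventually_le_const one_pos)
  refine tendsto_of_tendsto_of_tendsto_of_le_of_le' tendsto_const_nhds hlim
    (Eventually.of_forall fun _ => zero_le) ?_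
  filter_upwards [hsmall] with k hk
  have hε := hε_pos k
  set S := {j | latticePoint (ε k) j ∈ Ω \ innerSet Ω δ' ∧ u k j ≠ u₀ k j} with hS
  have e1 : ∑' _ : S, ENNReal.ofReal (ε k) ^ n
      = 2 ^ n * ∑' _ : S, ENNReal.ofReal (ε k / 2) ^ n := by
    rw [← ENNReal.tsum_mul_left]
    congr 1
    funext _
    rw [← mul_pow]
    congr 1
    rw [← ENNReal.ofReal_ofNat, ← ENNReal.ofReal_mul (by norm_num)]
    congr 1; ring
  rw [e1]
  gcongr
  -- Off the null set `Nu`, a point `x` in the box of a mismatch site lies in `A l` and `A₀ l` for a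
  -- common `l`. It cannot lie in phase `l` of both functions, since then both would equal `v l` at
  -- that site; so it lies in one of the two symmetric differences.
  calc ∑' _ : S, ENNReal.ofReal (ε k / 2) ^ n
      ≤ volume (Nu ∪ ⋃ l, ((symmDiff (phase h (v l) (ε k) (u k)) (A l) ∩ Q) ∪
        (symmDiff (phase h (v l) (ε k) (u₀ k)) (A₀ l) ∩ Q))) := by
        refine tsum_box_le hε (by linarith) S fun j hj x hx => ?_
        have hdist : dist x (latticePoint (ε k) j) ≤ n * ε k :=
          dist_latticePoint_le_of_box (by linarith) hx
        have hxδ : x ∉ innerSet Ω δ := fun hxδ =>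
          hj.1.2 (mem_innerSet_of_dist_le hδ' (r := n * ε k) (by linarith) hxδ hdist)
        have hxQ : x ∈ Q := by
          refine Metric.mem_thickening_iff.2 ⟨_, hj.1.1, hdist.trans_lt ?_⟩
          have : (n : ℝ) * ε k ≤ n * 1 := by gcongr; exact hk.2
          linarith
        by_cases hxN : x ∈ Nu
        · exact Or.inl hxN
        right
        simp only [hNu, mem_union, mem_compl_iff, mem_iUnion, not_or, not_exists] at hxN
        obtain ⟨hxA₀, hxA⟩ := hxN
        obtain ⟨l, hl⟩ := not_forall_not.1 hxA₀
        have hlA : x ∈ A l := by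
          by_contra hn
          exact hxA l ⟨mem_symmDiff.2 (Or.inr ⟨hl, hn⟩), hxδ⟩
        refine mem_iUnion.2 ⟨l, ?_⟩
        by_contra hcon
        simp only [mem_union, mem_inter_iff, mem_symmDiff, hxQ, hl, hlA, not_true, and_false,
          and_true, true_and, false_or, not_or, not_not] at hcon
        obtain ⟨h1, h2⟩ := hcon
        rw [mem_phase_iff hh hε] at h1 h2
        have hcell := inCell_cellIndex_of_box hh hε hx
        exact hj.2 ((h1 j hcell).trans (h2 j hcell).symm)
    _ ≤ 0 + ∑ l, (volume (symmDiff (phase h (v l) (ε k) (u k)) (A l) ∩ Q) +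
        volume (symmDiff (phase h (v l) (ε k) (u₀ k)) (A₀ l) ∩ Q)) := by
        refine (measure_union_le _ _).trans (add_le_add hNu0.le ?_)
        refine (measure_iUnion_fintype_le _ _).trans (Finset.sum_le_sum fun l _ => ?_)
        exact measure_union_le _ _
    _ = _ := zero_add _

/-- For integers `p` on one side of `g` the distances to `g` differ by at least 1, so their floors
are distinct; the factor 2 counts the two sides. -/
theorem sum_floor_abs_sub_le {B : ℕ → ℝ} (hB : Summable B) (hB0 : ∀ m, 0 ≤ B m) (g : ℝ)
    (P : Finset ℕ) : ∑ p ∈ P, B ⌊|g - p|⌋₊ ≤ 2 * ∑' m, B m := by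
  classical
  have key : ∀ Q : Finset ℕ, (∀ p ∈ Q, ∀ q ∈ Q, abs (abs (g - p) - abs (g - q)) = |(p : ℝ) - q|) →
      ∑ p ∈ Q, B ⌊|g - p|⌋₊ ≤ ∑' m, B m := by
    intro Q hQ
    rw [← Finset.sum_image (f := B) (g := fun p : ℕ => ⌊|g - p|⌋₊)]
    · exact hB.sum_le_tsum _ fun m _ => hB0 m
    · intro p hp q hq hpq
      simp only at hpq
      have h1 := hQ p hp q hq
      have h2 := Nat.floor_le (abs_nonneg (g - p))
      have h3 := Nat.floor_le (abs_nonneg (g - q))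
      have h4 := Nat.lt_floor_add_one (|g - p|)
      have h5 := Nat.lt_floor_add_one (|g - q|)
      rw [hpq] at h2 h4
      have h6 : |(p : ℝ) - q| < 1 := by
        rw [← h1, abs_lt]; constructor <;> linarith
      have h7 : |((p : ℤ) - q)| < 1 := by exact_mod_cast h6
      rw [Int.abs_lt_one_iff] at h7
      omega
  rw [← Finset.sum_filter_add_sum_filter_not P fun p : ℕ => (p : ℝ) < g, two_mul]
  refine add_le_add (key _ ?_) (key _ ?_)
  · intro p hp q hq
    have h1 := (Finset.mem_filter.1 hp).2
    have h2 := (Finset.mem_filter.1 hq).2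
    rw [abs_of_pos (sub_pos.2 h1), abs_of_pos (sub_pos.2 h2), abs_sub_comm (p : ℝ)]
    congr 1; ring
  · intro p hp q hq
    have h1 := not_lt.1 (Finset.mem_filter.1 hp).2
    have h2 := not_lt.1 (Finset.mem_filter.1 hq).2
    rw [abs_of_nonpos (sub_nonpos.2 h1), abs_of_nonpos (sub_nonpos.2 h2)]
    congr 1; ring

/-- The function which is `u` where `γ > p` and `u₀` elsewhere. -/
def glue {n : ℕ} {X : Type*} (γ : (Fin n → ℤ) → ℝ) (p : ℝ) (u u₀ : Config n X) : Config n X :=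
  open Classical in fun j => if p < γ j then u j else u₀ j

/-- The error made at the site `i` in replacing `glue γ p u u₀` with `u` or `u₀`. -/
def glueError {n : ℕ} {X : Type*} (φ : Config n X → ℝ) (γ : (Fin n → ℤ) → ℝ) (p : ℝ)
    (u u₀ : Config n X) (i : Fin n → ℤ) : ℝ :=
  open Classical in
  |φ (shift i (glue γ p u u₀)) - φ (shift i (if p < γ i then u else u₀))|

theorem abs_sub_le_of_agree {n : ℕ} {X : Type*} {φ : Config n X → ℝ} {c : ℕ → ℝ}
    (hc : ∀ m : ℕ, 1 ≤ m → ∀ z w : Config n X,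
      (∀ j, InCube 0 (m : ℝ) j → z j = w j) → |φ w - φ z| ≤ c m)
    {m : ℕ} (hm : 1 ≤ m) {z w : Config n X} (i : Fin n → ℤ)
    (h : ∀ j, InCube i (m : ℝ) j → z j = w j) :
    |φ (shift i w) - φ (shift i z)| ≤ c m :=
  hc m hm _ _ fun j hj => h _ fun a => by simpa using hj a

/-- The sites in the cube of side `m` around `i` have levels within `m / 2` of `γ i`, hence on the
same side of the cut as `i`. -/
theorem glueError_le_of_le_dist {n : ℕ} {X : Type*} {φ : Config n X → ℝ} {c : ℕ → ℝ}
    (hc : ∀ m : ℕ, 1 ≤ m → ∀ z w : Config n X,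
      (∀ j, InCube 0 (m : ℝ) j → z j = w j) → |φ w - φ z| ≤ c m)
    {γ : (Fin n → ℤ) → ℝ} (hγ : ∀ (i j : Fin n → ℤ) (r : ℝ),
      (∀ a, |((j a - i a : ℤ) : ℝ)| ≤ r) → |γ j - γ i| ≤ r)
    {m : ℕ} (hm : 1 ≤ m) {p : ℝ} {i : Fin n → ℤ} (hmi : (m : ℝ) ≤ |γ i - p|) (u u₀ : Config n X) :
    glueError φ γ p u u₀ i ≤ c m := by
  classical
  refine abs_sub_le_of_agree hc hm i fun j hj => ?_
  have h1 := abs_le.1 (hγ i j (m / 2) fun a => (hj a).le)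
  have hm0 : (1 : ℝ) ≤ m := by exact_mod_cast hm
  by_cases hp : p < γ i
  · rw [abs_of_pos (sub_pos.2 hp)] at hmi
    have : p < γ j := by linarith
    simp [glue, hp, this]
  · rw [abs_of_nonpos (sub_nonpos.2 (not_lt.1 hp))] at hmi
    have : ¬ p < γ j := by linarith
    simp [glue, hp, this]

theorem glueError_le_of_agree {n : ℕ} {X : Type*} {φ : Config n X → ℝ} {c : ℕ → ℝ}
    (hc : ∀ m : ℕ, 1 ≤ m → ∀ z w : Config n X,
      (∀ j, InCube 0 (m : ℝ) j → z j = w j) → |φ w - φ z| ≤ c m)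
    {γ : (Fin n → ℤ) → ℝ} {m : ℕ} (hm : 1 ≤ m) {p : ℝ} {i : Fin n → ℤ} {u u₀ : Config n X}
    (h : ∀ j, InCube i (m : ℝ) j → u j = u₀ j) :
    glueError φ γ p u u₀ i ≤ c m := by
  classical
  refine abs_sub_le_of_agree hc hm i fun j hj => ?_
  have := h j hj
  by_cases hp : p < γ i <;> by_cases hq : p < γ j <;> simp [glue, hp, hq, this]

theorem glueError_le {n : ℕ} {X : Type*} {φ : Config n X → ℝ} {L : ℝ}
    (hφ : ∀ u, 0 ≤ φ u ∧ φ u ≤ L) (γ : (Fin n → ℤ) → ℝ) (p : ℝ) (u u₀ : Config n X)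
    (i : Fin n → ℤ) : glueError φ γ p u u₀ i ≤ L := by
  classical
  unfold glueError
  rw [abs_le]
  have h1 := hφ (shift i (glue γ p u u₀))
  have h2 := hφ (shift i (if p < γ i then u else u₀))
  constructor <;> linarith

theorem glueError_nonneg {n : ℕ} {X : Type*} (φ : Config n X → ℝ) (γ : (Fin n → ℤ) → ℝ) (p : ℝ)
    (u u₀ : Config n X) (i : Fin n → ℤ) : 0 ≤ glueError φ γ p u u₀ i := abs_nonneg _

/-- Cuts at distance at least `D` from `γ i` cost `c m`, with `m` the integer part of that distance;
closer cuts cost at most `M`. Each integer part occurs for at most two levels. -/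
theorem sum_glueError_le {n : ℕ} {X : Type*} {φ : Config n X → ℝ}
    {c : ℕ → ℝ} (hcs : Summable c) (hc0 : ∀ m, 0 ≤ c m)
    (hc : ∀ m : ℕ, 1 ≤ m → ∀ z w : Config n X,
      (∀ j, InCube 0 (m : ℝ) j → z j = w j) → |φ w - φ z| ≤ c m)
    {γ : (Fin n → ℤ) → ℝ} (hγ : ∀ (i j : Fin n → ℤ) (r : ℝ),
      (∀ a, |((j a - i a : ℤ) : ℝ)| ≤ r) → |γ j - γ i| ≤ r)
    (u u₀ : Config n X) (P : Finset ℕ) {D : ℕ} (hD : 1 ≤ D) (i : Fin n → ℤ) {M : ℝ} (hM0 : 0 ≤ M)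
    (hM : ∀ p ∈ P, |γ i - p| < D → glueError φ γ p u u₀ i ≤ M) :
    ∑ p ∈ P, glueError φ γ p u u₀ i ≤ 2 * (D * M + ∑' m, c (m + D)) := by
  set B : ℕ → ℝ := fun m => if m < D then M else c m with hB
  have hBD : ∀ m, B (m + D) = c (m + D) := fun m => by simp [hB]
  have hBs : Summable B := by
    rw [← summable_nat_add_iff D]
    simp only [hBD]
    exact (summable_nat_add_iff D).2 hcs
  have hB0 : ∀ m, 0 ≤ B m := fun m => by
    simp only [hB]; split_ifs
    · exact hM0
    · exact hc0 m
  have hBt : ∑' m, B m = D * M + ∑' m, c (m + D) := by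
    rw [← hBs.sum_add_tsum_nat_add D]
    simp only [hBD]
    congr 1
    rw [Finset.sum_congr rfl (g := fun _ => M) fun m hm => by
      simp [hB, Finset.mem_range.1 hm]]
    simp
  rw [← hBt]
  refine le_trans (Finset.sum_le_sum fun p hp => ?_) (sum_floor_abs_sub_le hBs hB0 (γ i) P)
  simp only [hB]
  have hfl : ⌊|γ i - p|⌋₊ < D ↔ |γ i - p| < D := by
    rw [Nat.floor_lt (abs_nonneg _)]
  split_ifs with h
  · exact hM p hp (hfl.1 h)
  · exact glueError_le_of_le_dist hc hγ (by omega) (Nat.floor_le (abs_nonneg _)) u u₀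

/-- Among the cuts at the levels `p ∈ P` there is one for which the total error is at most the
average one. -/
theorem exists_cut {n : ℕ} {X : Type*} {φ : Config n X → ℝ} {L : ℝ}
    (hφ : ∀ u, 0 ≤ φ u ∧ φ u ≤ L) {c : ℕ → ℝ} (hcs : Summable c) (hc0 : ∀ m, 0 ≤ c m)
    (hc : ∀ m : ℕ, 1 ≤ m → ∀ z w : Config n X,
      (∀ j, InCube 0 (m : ℝ) j → z j = w j) → |φ w - φ z| ≤ c m)
    {γ : (Fin n → ℤ) → ℝ} (hγ : ∀ (i j : Fin n → ℤ) (r : ℝ),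
      (∀ a, |((j a - i a : ℤ) : ℝ)| ≤ r) → |γ j - γ i| ≤ r)
    {u u₀ : Config n X} {P : Finset ℕ} (hP : P.Nonempty) {D D' : ℕ} (hD : 1 ≤ D) (hD' : 1 ≤ D')
    (I Bad : Finset (Fin n → ℤ))
    (hBad : ∀ i ∈ I, ∀ p ∈ P, |γ i - p| < D → ∀ j, InCube i (D' : ℝ) j → u j ≠ u₀ j → j ∈ Bad) :
    ∃ p ∈ P, (P.card : ℝ) * ∑ i ∈ I, glueError φ γ p u u₀ i ≤
      I.card * (2 * (D * c D' + ∑' m, c (m + D))) +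
      Bad.card * (finite_box (D' : ℤ) (0 : Fin n → ℤ)).toFinset.card * (2 * (D * L)) := by
  classical
  have hL : 0 ≤ L := (hφ u).1.trans (hφ u).2
  set Box := (finite_box (D' : ℤ) (0 : Fin n → ℤ)).toFinset with hBox
  -- Only sites with a mismatch in their cube of side `D'` need the crude bound `L`. Each is a bad
  -- site minus an offset in `Box`, which bounds their number.
  set near : Finset (Fin n → ℤ) :=
    I.filter fun i => ∃ j ∈ Bad, InCube i (D' : ℝ) j with hnear
  have hcard : near.card ≤ Bad.card * Box.card := by
    rw [← Finset.card_product]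
    have : near ⊆ (Bad ×ˢ Box).image fun q => q.1 - q.2 := by
      intro i hi
      obtain ⟨-, j, hj, hij⟩ := Finset.mem_filter.1 hi
      refine Finset.mem_image.2 ⟨(j, j - i), Finset.mem_product.2 ⟨hj, ?_⟩, by simp⟩
      rw [hBox, Set.Finite.mem_toFinset]
      intro a
      have h1 := hij a
      have : ((|(j - i) a - (0 : Fin n → ℤ) a| : ℤ) : ℝ) ≤ (D' : ℝ) := by
        have : (0 : ℝ) ≤ D' := by positivity
        simp only [Pi.sub_apply, Pi.zero_apply, sub_zero]
        push_cast at h1 ⊢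
        linarith
      exact_mod_cast this
    exact (Finset.card_le_card this).trans Finset.card_image_le
  have hsite : ∀ i ∈ I, ∑ p ∈ P, glueError φ γ p u u₀ i
      ≤ 2 * (D * c D' + ∑' m, c (m + D)) + if i ∈ near then 2 * (D * L) else 0 := by
    intro i hi
    by_cases hn : i ∈ near
    · rw [if_pos hn]
      have h1 := sum_glueError_le hcs hc0 hc hγ u u₀ P hD i hL
        fun p _ _ => glueError_le hφ γ p u u₀ i
      have h2 : 0 ≤ (D : ℝ) * c D' := mul_nonneg (by positivity) (hc0 _)
      linarith
    · rw [if_neg hn, add_zero]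
      refine sum_glueError_le hcs hc0 hc hγ u u₀ P hD i (hc0 _) fun p hp hip => ?_
      refine glueError_le_of_agree hc hD' fun j hj => ?_
      by_contra hne
      exact hn (Finset.mem_filter.2 ⟨hi, j, hBad i hi p hp hip j hj hne, hj⟩)
  obtain ⟨p, hp, hle⟩ := Finset.exists_min_image P
    (fun p : ℕ => ∑ i ∈ I, glueError φ γ p u u₀ i) hP
  refine ⟨p, hp, ?_⟩
  calc (P.card : ℝ) * ∑ i ∈ I, glueError φ γ p u u₀ i
      = ∑ _q ∈ P, ∑ i ∈ I, glueError φ γ p u u₀ i := by simp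
    _ ≤ ∑ q ∈ P, ∑ i ∈ I, glueError φ γ q u u₀ i := Finset.sum_le_sum fun q hq => hle q hq
    _ = ∑ i ∈ I, ∑ q ∈ P, glueError φ γ q u u₀ i := Finset.sum_comm
    _ ≤ ∑ i ∈ I, (2 * (D * c D' + ∑' m, c (m + D)) + if i ∈ near then 2 * (D * L) else 0) :=
        Finset.sum_le_sum hsite
    _ = I.card * (2 * (D * c D' + ∑' m, c (m + D))) + near.card * (2 * (D * L)) := by
        rw [Finset.sum_add_distrib, Finset.sum_const, nsmul_eq_mul, ← Finset.sum_filter,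
          Finset.sum_const, nsmul_eq_mul, Finset.filter_mem_eq_inter,
          Finset.inter_eq_right.2 (Finset.filter_subset _ _)]
    _ ≤ _ := by
        gcongr
        exact_mod_cast hcard

theorem energy_glue_le {n : ℕ} {X : Type*} {φ : Config n X → ℝ} {ε : ℝ} (hε : 0 < ε)
    {Ω Ω' : Set (Space n)} {γ : (Fin n → ℤ) → ℝ} {p : ℝ}
    (hΩ' : ∀ i, latticePoint ε i ∈ Ω → γ i ≤ p → latticePoint ε i ∈ Ω')
    (u u₀ : Config n X) (I : Finset (Fin n → ℤ)) (hI : ∀ i, latticePoint ε i ∈ Ω → i ∈ I) :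
    energy φ ε (glue γ p u u₀) Ω ≤ energy φ ε u Ω + energy φ ε u₀ Ω' +
      ENNReal.ofReal (ε ^ (n - 1) * ∑ i ∈ I, glueError φ γ p u u₀ i) := by
  classical
  have e1 : ENNReal.ofReal (ε ^ (n - 1) * ∑ i ∈ I, glueError φ γ p u u₀ i)
      = ∑' i, (I : Set (Fin n → ℤ)).indicator
        (fun i => ENNReal.ofReal (ε ^ (n - 1) * glueError φ γ p u u₀ i)) i := by
    have h0 : ∀ i ∈ I, 0 ≤ ε ^ (n - 1) * glueError φ γ p u u₀ i := fun i _ =>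
      mul_nonneg (by positivity) (glueError_nonneg φ γ p u u₀ i)
    rw [Finset.mul_sum, ENNReal.ofReal_sum_of_nonneg h0, sum_eq_tsum_indicator]
  rw [e1, energy_eq_tsum_indicator, energy_eq_tsum_indicator, energy_eq_tsum_indicator,
    ← ENNReal.tsum_add, ← ENNReal.tsum_add]
  refine ENNReal.tsum_le_tsum fun i => ?_
  by_cases hi : latticePoint ε i ∈ Ω
  · have hiI : i ∈ (I : Set (Fin n → ℤ)) := hI i hi
    rw [indicator_of_mem (s := {i | latticePoint ε i ∈ Ω}) (by exact hi), indicator_of_mem hiI]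
    have hle : φ (shift i (glue γ p u u₀)) ≤ φ (shift i (if p < γ i then u else u₀)) +
        glueError φ γ p u u₀ i := by
      have := le_abs_self (φ (shift i (glue γ p u u₀)) - φ (shift i (if p < γ i then u else u₀)))
      unfold glueError
      linarith
    have hle' : ENNReal.ofReal (ε ^ (n - 1) * φ (shift i (glue γ p u u₀))) ≤
        ENNReal.ofReal (ε ^ (n - 1) * φ (shift i (if p < γ i then u else u₀))) +
        ENNReal.ofReal (ε ^ (n - 1) * glueError φ γ p u u₀ i) := by
      refine le_trans (ENNReal.ofReal_le_ofReal ?_) ENNReal.ofReal_add_le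
      rw [← mul_add]
      gcongr
    refine hle'.trans (add_le_add ?_ le_rfl)
    by_cases hp : p < γ i
    · rw [if_pos hp, indicator_of_mem (s := {i | latticePoint ε i ∈ Ω}) (by exact hi)]
      exact le_self_add
    · rw [if_neg hp, indicator_of_mem (s := {i | latticePoint ε i ∈ Ω'})
        (by exact hΩ' i hi (not_lt.1 hp))]
      exact le_add_self
  · rw [indicator_of_notMem (s := {i | latticePoint ε i ∈ Ω}) (by exact hi)]
    exact zero_le

/-! ### Recovery sequences with prescribed boundary values -/

theorem site_latticePoint {n : ℕ} {ε : ℝ} (hε : 0 < ε) (i : Fin n → ℤ) :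
    site ε (latticePoint ε i) = i :=
  (site_eq_iff hε _ _).2 fun _ => ⟨le_rfl, by simpa [latticePoint] using hε⟩

theorem finite_latticePoint_mem {n : ℕ} {ε : ℝ} (hε : 0 < ε) {Ω : Set (Space n)}
    (hΩ : Bornology.IsBounded Ω) : {i : Fin n → ℤ | latticePoint ε i ∈ Ω}.Finite :=
  (finite_site_image hε hΩ).subset fun i hi => ⟨_, hi, site_latticePoint hε i⟩

theorem tsum_const_eq_card_mul {α : Type*} {S : Set α} (hS : S.Finite) (c : ℝ≥0∞) :
    ∑' _ : S, c = hS.toFinset.card * c := by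
  have : Fintype S := hS.fintype
  rw [tsum_fintype, Finset.sum_const, nsmul_eq_mul]
  congr 2
  rw [Finset.card_univ, Set.Finite.card_toFinset]

theorem card_mul_pow_eq {α : Type*} {S : Set α} (hS : S.Finite) {ε : ℝ} (hε : 0 ≤ ε) (n : ℕ) :
    (hS.toFinset.card : ℝ) * ε ^ n = (∑' _ : S, ENNReal.ofReal ε ^ n).toReal := by
  rw [tsum_const_eq_card_mul hS]
  simp [ENNReal.toReal_ofReal hε]

/-- With at least `1 / (T ε)` levels, the best cut costs at most `T εⁿ` times the error summed over
all sites and levels. The constants are fixed in the order `D`, `D'`, `k`: `D` makes the tail of `c`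
small, `D'` makes `D * c D'` small, and for large `k` the number of mismatches times `εⁿ` is small
enough to absorb the crude bound at the sites near them. -/
theorem eventually_exists_discreteAdmissible_le {n K h : ℕ} (hn : 1 ≤ n) (hh : 1 ≤ h)
    {X : Type*} {φ : Config n X → ℝ} {L : ℝ} (hφ : ∀ u, 0 ≤ φ u ∧ φ u ≤ L)
    {v : Fin K → Config n X} (H3 : MildlyNonlocal φ)
    {Ω : Set (Space n)} (hΩ : Bornology.IsBounded Ω) {A A₀ : Fin K → Set (Space n)}
    (hA₀ : IsFinitePerimeterPartition A₀)
    {ε : ℕ → ℝ} (hε_pos : ∀ k, 0 < ε k) (hε_lim : Tendsto ε atTop (𝓝 0))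
    {u u₀ : ℕ → Config n X} (hu : ConvergesTo h v ε u A) (hu₀ : ConvergesTo h v ε u₀ A₀)
    {δ δ' : ℝ} (hδ' : 0 < δ') (hδ : 2 * δ' < δ)
    (hA : ∀ l, volume (symmDiff (A l) (A₀ l) ∩ (innerSet Ω δ)ᶜ) = 0) {η : ℝ} (hη : 0 < η) :
    ∀ᶠ k in atTop, ∃ w ∈ discreteAdmissible Ω (ε k) δ' (u₀ k),
      energy φ (ε k) w Ω ≤ energy φ (ε k) (u k) Ω +
        energy φ (ε k) (u₀ k) (Ω \ closure (innerSet Ω (2 * δ'))) + ENNReal.ofReal η := by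
  obtain ⟨c, hcs, hc0, hc⟩ := H3.exists_summable
  have hn0 : (0 : ℝ) < n := by exact_mod_cast hn
  have hL : 0 ≤ L := (hφ (u 0)).1.trans (hφ (u 0)).2
  set Q := Metric.thickening (n + 1) Ω with hQ
  have hQv : volume Q ≠ ⊤ := (hΩ.thickening (δ := (n : ℝ) + 1)).measure_lt_top.ne
  set V := (volume Q).toReal with hV
  -- The levels fill a layer of width `δ' / 2` with spacing `n ε`; after rounding at the ends at
  -- least `δ' / (4 n ε) = 1 / (T ε)` of them remain.
  set T := 4 * n / δ' with hT
  have hT0 : 0 < T := by positivity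
  have hV0 : 0 ≤ V := ENNReal.toReal_nonneg
  obtain ⟨D, hD, hDτ⟩ : ∃ D : ℕ, 1 ≤ D ∧ T * V * 2 * (∑' m, c (m + D)) ≤ η / 4 := by
    have h1 : Tendsto (fun D => T * V * 2 * (∑' m, c (m + D))) atTop (𝓝 (T * V * 2 * 0)) :=
      (tendsto_sum_nat_add c).const_mul _
    rw [mul_zero] at h1
    exact ((eventually_ge_atTop 1).and (h1.eventually_le_const (by positivity))).exists
  obtain ⟨D', hD', hDc⟩ : ∃ D' : ℕ, 1 ≤ D' ∧ T * V * 2 * D * c D' ≤ η / 4 := by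
    have h1 : Tendsto (fun D' => T * V * 2 * D * c D') atTop (𝓝 (T * V * 2 * D * 0)) :=
      hcs.tendsto_atTop_zero.const_mul _
    rw [mul_zero] at h1
    exact ((eventually_ge_atTop 1).and (h1.eventually_le_const (by positivity))).exists
  set Y : ℝ := (finite_box (D' : ℤ) (0 : Fin n → ℤ)).toFinset.card * (2 * (D * L)) with hY
  have hmis := tendsto_tsum_mismatch hh hΩ hA₀ hε_pos hε_lim hu hu₀ (by positivity) hδ hA
  have hmis' := (((ENNReal.tendsto_toReal ENNReal.zero_ne_top).comp hmis).const_mul (T * Y))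
  simp only [ENNReal.toReal_zero, mul_zero] at hmis'
  have hsc : ∀ C : ℝ, Tendsto (fun k => n * ε k * C) atTop (𝓝 0) := by
    intro C
    have h1 : Tendsto (fun k => n * ε k * C) atTop (𝓝 (n * 0 * C)) :=
      (hε_lim.const_mul _).mul_const _
    simpa using h1
  have hδ4 : 0 < δ' / 4 := by positivity
  filter_upwards [hmis'.eventually_le_const (half_pos hη), (hsc 1).eventually_le_const hδ4,
    (hsc (D + D')).eventually_le_const hδ4, hε_lim.eventually_le_const one_pos] with k hk1 hk2 hk3 hk4
  have hε := hε_pos k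
  rw [mul_one] at hk2
  have ht : 0 < n * ε k := by positivity
  -- Measured in units of `n ε`, the distance to the complement is 1-Lipschitz for the sup norm on
  -- the lattice.
  set γ : (Fin n → ℤ) → ℝ := fun i => Metric.infDist (latticePoint (ε k) i) Ωᶜ / (n * ε k) with hγ
  have hγd : ∀ i, Metric.infDist (latticePoint (ε k) i) Ωᶜ = n * ε k * γ i := fun i => by
    rw [hγ]; field_simp
  have hγL : ∀ (i j : Fin n → ℤ) (r : ℝ), (∀ a, |((j a - i a : ℤ) : ℝ)| ≤ r) →
      |γ j - γ i| ≤ r := by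
    intro i j r hr
    have h1 := dist_latticePoint_le hε.le hr
    have h2 := Metric.infDist_le_infDist_add_dist (s := Ωᶜ) (x := latticePoint (ε k) j)
      (y := latticePoint (ε k) i)
    have h3 := Metric.infDist_le_infDist_add_dist (s := Ωᶜ) (x := latticePoint (ε k) i)
      (y := latticePoint (ε k) j)
    rw [dist_comm] at h3
    rw [hγd, hγd] at h2 h3
    have h4 : n * (ε k * r) = n * ε k * r := by ring
    rw [abs_le]
    constructor <;> refine le_of_mul_le_mul_left ?_ ht <;> nlinarith
  -- Cuts stay between the distances `5/4 δ'` and `7/4 δ'`. The margins `δ' / 4` absorb shifts by `D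
  -- + D'` lattice units, so every mismatch that matters lies in `Ω` outside `Ω_{2δ'}`; and off
  -- `Ω_δ'` the glued function is `u₀`.
  set P : Finset ℕ := Finset.Icc ⌈5 / 4 * δ' / (n * ε k)⌉₊ ⌊7 / 4 * δ' / (n * ε k)⌋₊ with hP
  have hPmem : ∀ p ∈ P, 5 / 4 * δ' ≤ n * ε k * p ∧ n * ε k * p ≤ 7 / 4 * δ' := by
    intro p hp
    obtain ⟨h1, h2⟩ := Finset.mem_Icc.1 hp
    rw [Nat.ceil_le, div_le_iff₀' ht] at h1
    rw [Nat.le_floor_iff (by positivity), le_div_iff₀' ht] at h2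
    exact ⟨h1, h2⟩
  have hPcard : 1 ≤ T * ε k * P.card := by
    have h1 := Nat.ceil_lt_add_one (a := 5 / 4 * δ' / (n * ε k)) (by positivity)
    have h2 := Nat.lt_floor_add_one (7 / 4 * δ' / (n * ε k))
    have h3 : ((⌊7 / 4 * δ' / (n * ε k)⌋₊ : ℝ) + 1) - ⌈5 / 4 * δ' / (n * ε k)⌉₊ ≤ P.card := by
      rw [hP, Nat.card_Icc]
      have := Nat.sub_le_iff_le_add.1 (le_refl (⌊7 / 4 * δ' / (n * ε k)⌋₊ + 1 -
        ⌈5 / 4 * δ' / (n * ε k)⌉₊))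
      have : ((⌊7 / 4 * δ' / (n * ε k)⌋₊ + 1 : ℕ) : ℝ) ≤ ((⌊7 / 4 * δ' / (n * ε k)⌋₊ + 1 -
        ⌈5 / 4 * δ' / (n * ε k)⌉₊ + ⌈5 / 4 * δ' / (n * ε k)⌉₊ : ℕ) : ℝ) := by exact_mod_cast this
      push_cast at this
      linarith
    have h4 : 7 / 4 * δ' / (n * ε k) = 5 / 4 * δ' / (n * ε k) + 2 * (δ' / 4 / (n * ε k)) := by ring
    have h5 : 1 ≤ δ' / 4 / (n * ε k) := by rw [le_div_iff₀ ht]; linarith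
    have h6 : δ' / 4 / (n * ε k) ≤ P.card := by linarith
    have h7 : T * ε k * (δ' / 4 / (n * ε k)) = 1 := by rw [hT]; field_simp
    rw [← h7]
    gcongr
  have hPne : P.Nonempty := by
    rw [Finset.nonempty_iff_ne_empty]
    intro h0
    rw [h0] at hPcard
    norm_num at hPcard
  have hIfin := finite_latticePoint_mem hε hΩ
  set S := {j | latticePoint (ε k) j ∈ Ω \ innerSet Ω (2 * δ') ∧ u k j ≠ u₀ k j} with hS
  have hSfin : S.Finite := hIfin.subset fun j hj => hj.1.1
  obtain ⟨p, hp, hple⟩ := exists_cut hφ hcs hc0 hc hγL (u := u k) (u₀ := u₀ k) hPne hD hD'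
    hIfin.toFinset hSfin.toFinset (by
      intro i _ p hp hip j hj hne
      rw [Set.Finite.mem_toFinset]
      have h1 := hγL i j (D' / 2) fun a => (hj a).le
      obtain ⟨h2, h3⟩ := hPmem p hp
      rw [abs_lt] at hip
      rw [abs_le] at h1
      have hD0 : (0 : ℝ) ≤ D' := by positivity
      have h4 : n * ε k * γ j ≤ n * ε k * (p + (D + D')) := by
        gcongr; linarith
      have h5 : n * ε k * (p - (D + D')) ≤ n * ε k * γ j := by
        gcongr; linarith
      rw [← hγd] at h4 h5
      refine ⟨⟨?_, ?_⟩, hne⟩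
      · refine innerSet_subset (δ := 0) ((mem_innerSet_iff le_rfl).2 ?_)
        linarith
      · intro hmem
        have := hmem.2
        linarith)
  obtain ⟨hp1, hp2⟩ := hPmem p hp
  refine ⟨glue γ p (u k) (u₀ k), ?_, ?_⟩
  · intro i hi
    rw [mem_innerSet_iff hδ'.le, not_lt, hγd] at hi
    have : ¬ (p : ℝ) < γ i := by
      rw [not_lt]
      refine le_of_mul_le_mul_left ?_ ht
      linarith
    simp [glue, this]
  · refine (energy_glue_le (Ω' := Ω \ closure (innerSet Ω (2 * δ'))) hε (fun i hi hip => ⟨hi, ?_⟩)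
      (u k) (u₀ k) hIfin.toFinset (fun i hi => by simpa using hi)).trans ?_
    · intro hcl
      have hsub : closure (innerSet Ω (2 * δ')) ⊆ {x | 2 * δ' ≤ Metric.infDist x Ωᶜ} :=
        closure_minimal (fun x hx => hx.2.le)
          (isClosed_le continuous_const (Metric.continuous_infDist_pt _))
      have h1 : 2 * δ' ≤ Metric.infDist (latticePoint (ε k) i) Ωᶜ := hsub hcl
      have h2 : n * ε k * γ i ≤ n * ε k * p := by gcongr
      rw [← hγd] at h2
      linarith
    · gcongr
      set err := ∑ i ∈ hIfin.toFinset, glueError φ γ p (u k) (u₀ k) i with herr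
      have herr0 : 0 ≤ err := Finset.sum_nonneg fun i _ => glueError_nonneg _ _ _ _ _ _
      have hI : (hIfin.toFinset.card : ℝ) * ε k ^ n ≤ V := by
        rw [card_mul_pow_eq hIfin hε.le, hV]
        refine ENNReal.toReal_mono hQv (tsum_box_le hε le_rfl _ fun i hi x hx => ?_)
        refine Metric.mem_thickening_iff.2 ⟨_, hi,
          (dist_latticePoint_le_of_box le_rfl hx).trans_lt ?_⟩
        nlinarith
      have hB : T * Y * ((hSfin.toFinset.card : ℝ) * ε k ^ n) ≤ η / 2 := by
        rw [card_mul_pow_eq hSfin hε.le]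
        exact hk1
      have hτ0 : 0 ≤ ∑' m, c (m + D) := tsum_nonneg fun m => hc0 _
      have hX0 : 0 ≤ 2 * (D * c D' + ∑' m, c (m + D)) := by
        have := hc0 D'
        positivity
      calc ε k ^ (n - 1) * err ≤ ε k ^ (n - 1) * (T * ε k * P.card * err) := by
            gcongr
            exact le_mul_of_one_le_left herr0 hPcard
        _ = T * ε k ^ n * (P.card * err) := by
            rw [show ε k ^ n = ε k ^ (n - 1) * ε k by rw [← pow_succ, Nat.sub_add_cancel hn]]
            ring
        _ ≤ T * ε k ^ n * (hIfin.toFinset.card * (2 * (D * c D' + ∑' m, c (m + D))) +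
            hSfin.toFinset.card * (finite_box (D' : ℤ) (0 : Fin n → ℤ)).toFinset.card *
              (2 * (D * L))) := by gcongr
        _ = T * (hIfin.toFinset.card * ε k ^ n) * (2 * (D * c D' + ∑' m, c (m + D))) +
            T * Y * (hSfin.toFinset.card * ε k ^ n) := by rw [hY]; ring
        _ ≤ T * V * (2 * (D * c D' + ∑' m, c (m + D))) + η / 2 := by gcongr
        _ ≤ η := by linarith

theorem iInf_limsup_discreteMin_le {n K h : ℕ} (hn : 1 ≤ n) (hh : 1 ≤ h)
    {X : Type*} {φ : Config n X → ℝ} {L : ℝ} (hφ : ∀ u, 0 ≤ φ u ∧ φ u ≤ L)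
    {v : Fin K → Config n X} (H3 : MildlyNonlocal φ)
    {Ω : Set (Space n)} (hΩ : Bornology.IsBounded Ω) {A A₀ : Fin K → Set (Space n)}
    (hA₀ : IsFinitePerimeterPartition A₀)
    {ε : ℕ → ℝ} (hε_pos : ∀ k, 0 < ε k) (hε_lim : Tendsto ε atTop (𝓝 0))
    {F₀ : (Fin K → Set (Space n)) → ℝ≥0∞} (hF₀ : IsGammaLimit φ h v ε Ω F₀)
    {u₀ : ℕ → Config n X} (hu₀ : ConvergesTo h v ε u₀ A₀)
    (hu₀_energy : (⨅ (δ : ℝ) (_ : 0 < δ),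
      limsup (fun k => energy φ (ε k) (u₀ k) (Ω \ closure (innerSet Ω (2 * δ)))) atTop) = 0)
    {δ : ℝ} (hδ : 0 < δ) (hA : A ∈ continuumAdmissible Ω δ A₀) :
    (⨅ (δ : ℝ) (_ : 0 < δ), limsup (fun k => discreteMin φ Ω (ε k) δ (u₀ k)) atTop) ≤ F₀ A := by
  obtain ⟨-, u, hu, hlim⟩ := hF₀ A hA.1
  refine ENNReal.le_of_forall_pos_le_add fun η hη htop => ?_
  have hη0 : (0 : ℝ) < η / 3 := by positivity
  have hη3 : (0 : ℝ≥0∞) < η / 3 := ENNReal.div_pos (by exact_mod_cast hη.ne') (by norm_num)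
  have hlt₀ := hη3
  rw [← hu₀_energy] at hlt₀
  obtain ⟨δ₁, hδ₁⟩ := iInf_lt_iff.1 hlt₀
  obtain ⟨hδ₁0, hlt⟩ := iInf_lt_iff.1 hδ₁
  -- The bound by `δ₁` keeps the energy of `u₀` near the boundary small; the bound by `δ / 4` places
  -- the cut where `A` and `A₀` agree.
  set δ' := min δ₁ (δ / 4) with hδ'
  have hδ'0 : 0 < δ' := lt_min hδ₁0 (by positivity)
  have h2δ : 2 * δ' < δ := by
    have := min_le_right δ₁ (δ / 4)
    linarith
  refine iInf₂_le_of_le δ' hδ'0 ?_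
  have hev := eventually_exists_discreteAdmissible_le hn hh hφ H3 hΩ hA₀ hε_pos hε_lim hu hu₀ hδ'0
    h2δ hA.2 hη0
  have hηe : ENNReal.ofReal ((η : ℝ) / 3) = η / 3 := by
    rw [ENNReal.ofReal_div_of_pos (by norm_num)]
    simp
  have hmono : ∀ k, energy φ (ε k) (u₀ k) (Ω \ closure (innerSet Ω (2 * δ'))) ≤
      energy φ (ε k) (u₀ k) (Ω \ closure (innerSet Ω (2 * δ₁))) := by
    intro k
    simp only [energy_eq_tsum_indicator]
    refine ENNReal.tsum_le_tsum fun i => indicator_le_indicator_of_subset ?_ (fun _ => zero_le) i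
    refine fun i hi => ⟨hi.1, fun hcl => hi.2 (closure_mono (innerSet_anti ?_) hcl)⟩
    have := min_le_left δ₁ (δ / 4)
    linarith
  refine limsup_le_of_le (by isBoundedDefault) ?_
  filter_upwards [hev, eventually_lt_of_limsup_lt hlt (by isBoundedDefault),
    eventually_lt_of_limsup_lt (hlim.trans_lt (ENNReal.lt_add_right htop.ne hη3.ne'))
      (by isBoundedDefault)] with k hk hk₀ hk₁
  obtain ⟨w, hw, hle⟩ := hk
  calc discreteMin φ Ω (ε k) δ' (u₀ k) ≤ energy φ (ε k) w Ω := iInf₂_le w hw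
    _ ≤ F₀ A + η / 3 + η / 3 + η / 3 := by
        refine hle.trans ?_
        rw [hηe]
        gcongr
        exact (hmono k).trans hk₀.le
    _ = F₀ A + η := by rw [add_assoc, add_assoc, ← add_assoc (_ / 3), ENNReal.add_thirds]

/-! ### The lower bound and the existence of minimizers -/

/-- The lattice points of the cell of `x` are, after scaling, within `n ε h` of `x`, so they miss
`Ω_δ`, the only place where `u` and `u₀` may differ. -/
theorem mem_phase_iff_of_discreteAdmissible {n h : ℕ} (hh : 1 ≤ h) {X : Type*} {v u u₀ : Config n X}
    {Ω : Set (Space n)} {ε δ δ' : ℝ} (hε : 0 < ε) (hδ' : 0 ≤ δ') (hδ : δ' + n * (ε * h) ≤ δ)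
    (hu : u ∈ discreteAdmissible Ω ε δ u₀) {x : Space n} (hx : x ∉ innerSet Ω δ') :
    x ∈ phase h v ε u ↔ x ∈ phase h v ε u₀ := by
  rw [mem_phase_iff hh hε, mem_phase_iff hh hε]
  refine forall₂_congr fun j hj => ?_
  rw [hu j fun hmem => hx (mem_innerSet_of_dist_le hδ' hδ hmem ?_)]
  refine dist_le_mul_of_coord fun a => ?_
  have h1 := hj a
  have h2 := inCell_cellIndex hh ε x a
  have h3 : x a = ε * (x a / ε) := by field_simp
  simp only [latticePoint]
  rw [h3, ← mul_sub, abs_mul, abs_of_pos hε]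
  gcongr
  rw [abs_le]
  constructor <;> linarith

theorem continuumMin_le_liminf_discreteMin {n K h : ℕ} (hn : 1 ≤ n) (hh : 1 ≤ h) {X : Type*}
    {φ : Config n X → ℝ} (hφ : ∀ u, 0 ≤ φ u) {v : Fin K → Config n X}
    (hv_inj : Function.Injective v) (hv_per : ∀ l, IsPeriodic h (v l))
    (H1 : GroundStates φ v) (H2 : Coercive φ h v) (H3 : MildlyNonlocal φ)
    {Ω : Set (Space n)} (hΩ : Bornology.IsBounded Ω)
    {A₀ : Fin K → Set (Space n)} (hA₀ : IsFinitePerimeterPartition A₀)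
    {ε : ℕ → ℝ} (hε_pos : ∀ k, 0 < ε k) (hε_lim : Tendsto ε atTop (𝓝 0))
    {F₀ : (Fin K → Set (Space n)) → ℝ≥0∞} (hF₀ : IsGammaLimit φ h v ε Ω F₀)
    {u₀ : ℕ → Config n X} (hu₀ : ConvergesTo h v ε u₀ A₀)
    {δ δ' : ℝ} (hδ' : 0 < δ') (hδ : δ' < δ) :
    continuumMin F₀ Ω δ' A₀ ≤ liminf (fun k => discreteMin φ Ω (ε k) δ (u₀ k)) atTop := by
  by_contra! hlt
  obtain ⟨b, hb1, hb2⟩ := exists_between hlt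
  obtain ⟨κ, hκ, hκb⟩ := extraction_of_frequently_atTop (frequently_lt_of_liminf_lt (by isBoundedDefault) hb1)
  have hw : ∀ j, ∃ w ∈ discreteAdmissible Ω (ε (κ j)) δ (u₀ (κ j)), energy φ (ε (κ j)) w Ω < b := by
    intro j
    obtain ⟨w, hw⟩ := iInf_lt_iff.1 (hκb j)
    obtain ⟨hw1, hw2⟩ := iInf_lt_iff.1 hw
    exact ⟨w, hw1, hw2⟩
  choose w hwA hwb using hw
  have hsmall : ∀ᶠ j in atTop, n * (ε (κ j) * h) ≤ δ - δ' := by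
    have h1 : Tendsto (fun j => n * (ε (κ j) * h)) atTop (𝓝 (n * (0 * h))) :=
      ((hε_lim.comp hκ.tendsto_atTop).mul_const _).const_mul _
    rw [zero_mul, mul_zero] at h1
    exact h1.eventually_le_const (by linarith)
  obtain ⟨A, hA, hle⟩ := exists_continuumAdmissible_le hn hh hφ hv_inj hv_per H1 H2 H3 hΩ hA₀
    hε_pos hε_lim hF₀ hκ (u := w) hδ' (b := fun _ => b) hb2.ne_top tendsto_const_nhds
    (fun j => (hwb j).le) (by
      intro l R hR
      refine tendsto_of_tendsto_of_tendsto_of_le_of_le' tendsto_const_nhds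
        ((hu₀ l R hR).comp hκ.tendsto_atTop) (Eventually.of_forall fun _ => zero_le) ?_
      filter_upwards [hsmall] with j hj
      refine measure_mono ?_
      rintro x ⟨⟨hx, hxQ⟩, hxδ⟩
      refine ⟨?_, hxQ⟩
      rw [mem_symmDiff] at hx ⊢
      rwa [← mem_phase_iff_of_discreteAdmissible hh (hε_pos (κ j)) hδ'.le (by linarith) (hwA j) hxδ])
  exact absurd ((iInf₂_le A hA).trans hle) (not_le.2 hb2)

/-- The direct method is run on the discrete side: a diagonal sequence drawn from recovery sequences
of a minimising sequence of partitions has energies bounded by `m + d j`, and compactness with the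
liminf inequality applies to it. -/
theorem exists_continuumAdmissible_eq_continuumMin {n K h : ℕ} (hn : 1 ≤ n) (hh : 1 ≤ h)
    {X : Type*} {φ : Config n X → ℝ} (hφ : ∀ u, 0 ≤ φ u) {v : Fin K → Config n X}
    (hv_inj : Function.Injective v) (hv_per : ∀ l, IsPeriodic h (v l))
    (H1 : GroundStates φ v) (H2 : Coercive φ h v) (H3 : MildlyNonlocal φ)
    {Ω : Set (Space n)} (hΩ : Bornology.IsBounded Ω)
    {A₀ : Fin K → Set (Space n)} (hA₀ : IsFinitePerimeterPartition A₀)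
    {ε : ℕ → ℝ} (hε_pos : ∀ k, 0 < ε k) (hε_lim : Tendsto ε atTop (𝓝 0))
    {F₀ : (Fin K → Set (Space n)) → ℝ≥0∞} (hF₀ : IsGammaLimit φ h v ε Ω F₀)
    {δ : ℝ} (hδ : 0 < δ) :
    ∃ A ∈ continuumAdmissible Ω δ A₀, F₀ A = continuumMin F₀ Ω δ A₀ := by
  -- If the infimum is infinite, `A₀` itself attains it.
  by_cases htop : continuumMin F₀ Ω δ A₀ = ⊤
  · have hA₀m : A₀ ∈ continuumAdmissible Ω δ A₀ := ⟨hA₀, fun l => by simp⟩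
    refine ⟨A₀, hA₀m, top_unique ?_ |>.trans htop.symm⟩
    rw [← htop]
    exact iInf₂_le A₀ hA₀m
  set m := continuumMin F₀ Ω δ A₀ with hm
  set d : ℕ → ℝ≥0∞ := fun j => ((j : ℝ≥0∞) + 1)⁻¹ with hd
  have hd0 : ∀ j, 0 < d j := fun j => by
    simp only [hd]
    exact ENNReal.inv_pos.2 (ENNReal.add_ne_top.2 ⟨ENNReal.natCast_ne_top j, ENNReal.one_ne_top⟩)
  have hdlim : Tendsto d atTop (𝓝 0) := by
    have := ENNReal.tendsto_inv_nat_nhds_zero.comp (tendsto_add_atTop_nat 1)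
    refine this.congr fun j => ?_
    simp [hd]
  have hA : ∀ j, ∃ A ∈ continuumAdmissible Ω δ A₀, F₀ A < m + d j := by
    intro j
    have h1 : m < m + d j := ENNReal.lt_add_right htop (hd0 j).ne'
    obtain ⟨A, hA⟩ := iInf_lt_iff.1 h1
    obtain ⟨hA1, hA2⟩ := iInf_lt_iff.1 hA
    exact ⟨A, hA1, hA2⟩
  choose A hAadm hAlt using hA
  have hrec : ∀ j, ∃ r : ℕ → Config n X, ConvergesTo h v ε r (A j) ∧
      limsup (fun k => energy φ (ε k) (r k) Ω) atTop ≤ F₀ (A j) := fun j => (hF₀ _ (hAadm j).1).2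
  choose r hrc hrl using hrec
  -- The cubes of side `j + 1` exhaust the space, so closeness `d j` on them controls every fixed
  -- `R` for large `j`.
  obtain ⟨κ, hκ, hκp⟩ := extraction_forall_of_eventually (P := fun j k =>
    energy φ (ε k) (r j k) Ω < m + d j ∧ ∀ l, volume (symmDiff (phase h (v l) (ε k) (r j k)) (A j l)
      ∩ {x : Space n | ∀ a, |x a| < ((j : ℝ) + 1) / 2}) < d j) (fun j => by
      refine (eventually_lt_of_limsup_lt ((hrl j).trans_lt (hAlt j))
        (by isBoundedDefault)).and (eventually_all.2 fun l => ?_)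
      exact (hrc j l _ (by positivity)).eventually_lt_const (hd0 j))
  obtain ⟨B, hB, hle⟩ := exists_continuumAdmissible_le hn hh hφ hv_inj hv_per H1 H2 H3 hΩ hA₀
    hε_pos hε_lim hF₀ hκ (u := fun j => r j (κ j)) hδ (b := fun j => m + d j) htop
    (by simpa using hdlim.const_add m) (fun j => (hκp j).1.le) (by
      intro l R hR
      refine tendsto_of_tendsto_of_tendsto_of_le_of_le' tendsto_const_nhds hdlim
        (Eventually.of_forall fun _ => zero_le) ?_
      obtain ⟨N, hN⟩ := exists_nat_ge R
      filter_upwards [eventually_ge_atTop N] with j hj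
      have hRj : R ≤ (j : ℝ) + 1 := by
        have : (N : ℝ) ≤ j := by exact_mod_cast hj
        linarith
      have hsub : symmDiff (phase h (v l) (ε (κ j)) (r j (κ j))) (A₀ l) ∩
          {x : Space n | ∀ a, |x a| < R / 2} ∩ (innerSet Ω δ)ᶜ ⊆
          (symmDiff (phase h (v l) (ε (κ j)) (r j (κ j))) (A j l) ∩
            {x : Space n | ∀ a, |x a| < ((j : ℝ) + 1) / 2}) ∪
          (symmDiff (A j l) (A₀ l) ∩ (innerSet Ω δ)ᶜ) := by
        rintro x ⟨⟨hx, hxR⟩, hxδ⟩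
        rcases symmDiff_triangle _ (A j l) _ hx with h1 | h1
        · exact Or.inl ⟨h1, fun a => (hxR a).trans_le (by linarith)⟩
        · exact Or.inr ⟨h1, hxδ⟩
      refine (measure_mono hsub).trans ((measure_union_le _ _).trans ?_)
      rw [(hAadm j).2 l, add_zero]
      exact ((hκp j).2 l).le)
  exact ⟨B, hB, le_antisymm hle (iInf₂_le B hB)⟩

/-- Only the finitely many sites in the bounded set `Ω_δ` are free, so finitely many functions
compete. -/
theorem exists_discreteAdmissible_eq_discreteMin {n : ℕ} {X : Type*} [Finite X]
    (φ : Config n X → ℝ) {Ω : Set (Space n)} (hΩ : Bornology.IsBounded Ω) {ε : ℝ} (hε : 0 < ε)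
    (δ : ℝ) (u₀ : Config n X) :
    ∃ u ∈ discreteAdmissible Ω ε δ u₀, energy φ ε u Ω = discreteMin φ Ω ε δ u₀ := by
  have hJ : {i : Fin n → ℤ | latticePoint ε i ∈ innerSet Ω δ}.Finite :=
    finite_latticePoint_mem hε (hΩ.subset innerSet_subset)
  have : Finite {i : Fin n → ℤ | latticePoint ε i ∈ innerSet Ω δ} := hJ
  have hfin : (discreteAdmissible Ω ε δ u₀).Finite := by
    refine Finite.of_injective
      (fun (u : discreteAdmissible Ω ε δ u₀) (i : {i : Fin n → ℤ | latticePoint ε i ∈ innerSet Ω δ})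
        => u.1 i.1) fun u w huw => Subtype.ext (funext fun i => ?_)
    by_cases hi : latticePoint ε i ∈ innerSet Ω δ
    · exact congrFun huw ⟨i, hi⟩
    · rw [u.2 i hi, w.2 i hi]
  obtain ⟨u, hu, hmin⟩ := Set.exists_min_image _ (fun u => energy φ ε u Ω) hfin
    ⟨u₀, fun i _ => rfl⟩
  exact ⟨u, hu, le_antisymm (le_iInf₂ hmin) (iInf₂_le u hu)⟩

end

end PatternEnergy

theorem proposition4p6 (n m K h : ℕ) (hn : 1 ≤ n) (hh : 1 ≤ h)
    (X : Set (EuclideanSpace ℝ (Fin m))) (L : ℝ)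
    (φ : Config n X → ℝ) (hφ : ∀ u, 0 ≤ φ u ∧ φ u ≤ L)
    (v : Fin K → Config n X) (hv_inj : Function.Injective v) (hv_per : ∀ l, IsPeriodic h (v l))
    (H1 : GroundStates φ v) (H2 : Coercive φ h v) (H3 : MildlyNonlocal φ)
    (Ω : Set (Space n)) (hΩ_bdd : Bornology.IsBounded Ω) (hΩ_lip : IsLipschitzSet Ω)
    (A₀ : Fin K → Set (Space n)) (hA₀ : IsFinitePerimeterPartition A₀)
    (ε : ℕ → ℝ) (hε_pos : ∀ k, 0 < ε k) (hε_lim : Tendsto ε atTop (𝓝 0))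
    (F₀ : (Fin K → Set (Space n)) → ℝ≥0∞) (hF₀ : IsGammaLimit φ h v ε Ω F₀)
    (u₀ : ℕ → Config n X) (hu₀ : ConvergesTo h v ε u₀ A₀)
    (hu₀_energy : (⨅ (δ : ℝ) (_ : 0 < δ),
      limsup (fun k => energy φ (ε k) (u₀ k) (Ω \ closure (innerSet Ω (2 * δ)))) atTop) = 0) :
    ((⨅ (δ : ℝ) (_ : 0 < δ), limsup (fun k => discreteMin φ Ω (ε k) δ (u₀ k)) atTop) ≤
        (⨅ (δ : ℝ) (_ : 0 < δ), continuumMin F₀ Ω δ A₀)) ∧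
      ((⨅ (δ : ℝ) (_ : 0 < δ), continuumMin F₀ Ω δ A₀) ≤
        (⨅ (δ : ℝ) (_ : 0 < δ), liminf (fun k => discreteMin φ Ω (ε k) δ (u₀ k)) atTop)) ∧
      (∀ δ : ℝ, 0 < δ → ∃ A ∈ continuumAdmissible Ω δ A₀, F₀ A = continuumMin F₀ Ω δ A₀) ∧
      (X.Finite → ∀ (k : ℕ) (δ : ℝ), 0 < δ →
        ∃ u ∈ discreteAdmissible Ω (ε k) δ (u₀ k),
          energy φ (ε k) u Ω = discreteMin φ Ω (ε k) δ (u₀ k)) := by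
  have hφ0 : ∀ u, 0 ≤ φ u := fun u => (hφ u).1
  refine ⟨?_, ?_, ?_, ?_⟩
  · exact le_iInf₂ fun δ hδ => le_iInf₂ fun A hA =>
      iInf_limsup_discreteMin_le hn hh hφ H3 hΩ_bdd hA₀ hε_pos hε_lim hF₀ hu₀ hu₀_energy hδ hA
  -- Passing to the limit weakens the constraint from `δ` to `δ / 2`, a loss that the infimum over
  -- `δ` absorbs.
  · exact le_iInf₂ fun δ hδ => iInf₂_le_of_le (δ / 2) (half_pos hδ)
      (continuumMin_le_liminf_discreteMin hn hh hφ0 hv_inj hv_per H1 H2 H3 hΩ_bdd hA₀ hε_pos hε_lim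
        hF₀ hu₀ (half_pos hδ) (half_lt_self hδ))
  · exact fun δ hδ => exists_continuumAdmissible_eq_continuumMin hn hh hφ0 hv_inj hv_per H1 H2 H3
      hΩ_bdd hA₀ hε_pos hε_lim hF₀ hδ
  · intro hX k δ _
    have : Finite X := hX
    exact exists_discreteAdmissible_eq_discreteMin φ hΩ_bdd (hε_pos k) δ (u₀ k)
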